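/- Let $\mathbb B_n$ be the open Euclidean unit ball of $\mathbb C^n$ and let $D\subset\mathbb C^n$ be a domain (a non-empty connected open set). For $z\in D$ let $\delta_D(z)=\operatorname{dist}(z,\partial D)$, and let $$s_D(z)=\sup\{r\ge 0 : r\,\mathbb B_n\subset f(D),\ f:D\to\mathbb B_n \text{ holomorphic and injective},\ f(z)=0\}$$ be the squeezing function of $D$, with $s_D(z)=0$ if no such $f$ exists (that is, if $D$ is not biholomorphic to a bounded domain). Let $p_0\in\partial D$ be a Dini-smooth boundary point of $D$: there are an open neighborhood $U$ of $p_0$ and a $\mathcal C^1$ function $r:U\to\mathbb R$ with nowhere vanishing differential such that $D\cap U=\{x\in U: r(x)<0\}$, and the inner unit normal $\nu=-\nabla r/|\nabla r|$ satisfies $$\int_0^1\frac{\omega(t)}{t}\,dt<\infty,\qquad \omega(t)=\sup\{|\nu(x)-\nu(y)| : x,y\in\partial D\cap U,\ |x-y|<t\}.$$ If $$\liminf_{D\ni z\to p_0}\frac{1-s_D(z)}{\delta_D(z)}=0,$$ then $D$ is biholomorphic to $\mathbb B_n$. -/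

import Mathlib

open Set Filter Topology MeasureTheory Metric
open scoped ENNReal Gradient

noncomputable section

/-- `r` is a `C¹` local defining function of the open set `D` on the open set `U`:
`D ∩ U = {x ∈ U : r x < 0}` and the differential of `r` vanishes nowhere on `U`.
In particular `∂D ∩ U = {x ∈ U : r x = 0}`. -/
def IsC1DefiningFunction {E : Type*} [NormedAddCommGroup E] [InnerProductSpace ℝ E]
    (D U : Set E) (r : E → ℝ) : Prop :=
  ContDiffOn ℝ 1 r U ∧ (∀ x ∈ U, fderiv ℝ r x ≠ 0) ∧ D ∩ U = {x ∈ U | r x < 0}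

/-- The inner unit normal at `x` given by a defining function `r`. On the boundary of `D` it
does not depend on the choice of `r`. -/
def innerUnitNormal {E : Type*} [NormedAddCommGroup E] [InnerProductSpace ℝ E] [CompleteSpace E]
    (r : E → ℝ) (x : E) : E :=
  -(‖∇ r x‖⁻¹ • ∇ r x)

/-- The modulus of continuity
`ω(N, S, t) = sup {|N x - N y| : x, y ∈ S, |x - y| < t}`, with values in `[0, ∞]`. -/
def continuityModulus {E F : Type*} [NormedAddCommGroup E] [NormedAddCommGroup F]
    (N : E → F) (S : Set E) (t : ℝ) : ℝ≥0∞ :=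
  ⨆ x ∈ S, ⨆ y ∈ S, ⨆ _ : ‖x - y‖ < t, ENNReal.ofReal ‖N x - N y‖

/-- `N` is Dini-continuous on `S`: `∫₀¹ ω(N, S, t) / t dt < ∞`. -/
def DiniContinuousOn {E F : Type*} [NormedAddCommGroup E] [NormedAddCommGroup F]
    (N : E → F) (S : Set E) : Prop :=
  ∫⁻ t in Ioo (0 : ℝ) 1, continuityModulus N S t / ENNReal.ofReal t < ∞

/-- `p` is a Dini-smooth boundary point of `D`: `p` is a `C¹`-smooth boundary point, and the
inner unit normal to `∂D` is Dini-continuous on `∂D` near `p`. -/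
def IsDiniSmoothBoundaryPoint {E : Type*} [NormedAddCommGroup E] [InnerProductSpace ℝ E]
    [CompleteSpace E] (D : Set E) (p : E) : Prop :=
  p ∈ frontier D ∧ ∃ (U : Set E) (r : E → ℝ), IsOpen U ∧ p ∈ U ∧
    IsC1DefiningFunction D U r ∧ DiniContinuousOn (innerUnitNormal r) (frontier D ∩ U)

/-- The squeezing function `s_D`: the supremum of all `r ≥ 0` such that `r𝔹ₙ ⊆ f(D)` for some
injective holomorphic `f : D → 𝔹ₙ` with `f z = 0`. It is `0` if there is no such `f`. -/
def squeezingFunction {n : ℕ} (D : Set (EuclideanSpace ℂ (Fin n)))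
    (z : EuclideanSpace ℂ (Fin n)) : ℝ :=
  sSup {r : ℝ | 0 ≤ r ∧ ∃ f : EuclideanSpace ℂ (Fin n) → EuclideanSpace ℂ (Fin n),
    DifferentiableOn ℂ f D ∧ MapsTo f D (ball 0 1) ∧ InjOn f D ∧ f z = 0 ∧ ball 0 r ⊆ f '' D}

/-- The distance `δ_D(z)` from `z` to the boundary of `D`. -/
def boundaryDist {E : Type*} [NormedAddCommGroup E] (D : Set E) (z : E) : ℝ :=
  infDist z (frontier D)

/-- `D` and `G` are biholomorphic. -/
def Biholomorphic {n : ℕ} (D G : Set (EuclideanSpace ℂ (Fin n))) : Prop :=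
  ∃ f g : EuclideanSpace ℂ (Fin n) → EuclideanSpace ℂ (Fin n),
    DifferentiableOn ℂ f D ∧ DifferentiableOn ℂ g G ∧ MapsTo f D G ∧ MapsTo g G D ∧
      InvOn g f D G

end

/-!
For `z` in `D` near `p₀` take an injection `f : D → 𝔹ₙ` with `f z = 0` whose image contains a ball
of radius `s` with `1 - s = o(δ_D(z))`. The key estimate is that there are a point `a₀` of `D` and a
constant `c > 0`, both independent of `z`, such that `1 - ‖f a‖ ≥ c δ_D(z)` at some point `a` close
to `a₀` (`IsDiniSmoothBoundaryPoint.exists_mul_boundaryDist_le`). So `1 - s = o(1 - ‖f a‖)`, and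
after composition with the automorphism of the ball that moves `f a` to `0` the image contains a
ball of radius tending to `1` (`ball_subset_image_ballInvolution`). Hence `D` has injections to the
ball, with zeros that converge to `a₀`, whose images exhaust the ball, and then `D` is biholomorphic
to the ball (`exists_biholomorphism_of_exhausting_injections`).

The key estimate is an upper bound for the hyperbolic distance of `z` and `a`, that is, it follows
from the Schwarz lemma on a holomorphic disc in `D` that joins them. If `p` is the nearest boundary
point of `z`, then `z` lies on the inner normal `ν` at `p`, and the complex line `p + ℂ ν` meets `D`
in a set that contains the region `Re ζ > 2 |Im ζ| ω(|ζ|)`, where `ω` is the modulus of continuity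
of the normal. The map `ζ ↦ ζ (1 + 64 ∑ ω(2⁻ᵏ) / (1 + 2ᵏ ζ))`, with the sum over large `k`, sends a
half-disc into this region (`two_mul_im_diniMap_lt`). The Dini condition says that the sum of the
`ω(2⁻ᵏ)` converges, so this map is comparable to the identity at `0`, and distances to the boundary
are preserved up to a factor.

For the limit, let `gⱼ` be the injections and `G` their limit along an ultrafilter. If `Φ` is a
bounded holomorphic map on `D`, then the maps `Φ ∘ gⱼ⁻¹` converge on the ball to a map `k` with
`k ∘ G = Φ`. With `Φ = g₀` this shows that `G` is injective. With `Φ = G` it shows that `k` is the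
identity on the image of `G`, hence on the ball, so that `G ∘ gⱼ⁻¹` is uniformly close to the
identity near each point `w` of the ball and takes the value `w`: `G` is surjective. The inverses
are holomorphic by Osgood's theorem (`injective_fderiv_of_injOn`).
-/

/-! ### Holomorphic maps of several variables -/

section HolomorphicMaps

theorem mapsTo_closedBall_two_mul {E F : Type*} [PseudoMetricSpace E] [SeminormedAddCommGroup F]
    {f : E → F} {x : E} {R M : ℝ} (hM : ∀ y ∈ ball x R, ‖f y‖ ≤ M) :
    MapsTo f (ball x R) (closedBall (f x) (2 * M)) := by
  intro y hy
  have hx : x ∈ ball x R := mem_ball_self (pos_of_mem_ball hy)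
  rw [mem_closedBall, dist_eq_norm]
  linarith [norm_sub_le (f y) (f x), hM y hy, hM x hx]

variable {E F : Type*} [NormedAddCommGroup E] [NormedSpace ℂ E]
  [NormedAddCommGroup F] [NormedSpace ℂ F] {f : E → F} {x y : E} {R M : ℝ}

theorem norm_fderiv_le_of_bound (hR : 0 < R) (hd : DifferentiableOn ℂ f (ball x R))
    (hM : ∀ y ∈ ball x R, ‖f y‖ ≤ M) : ‖fderiv ℂ f x‖ ≤ 2 * M / R :=
  Complex.norm_fderiv_le_div_of_mapsTo_ball hd (mapsTo_closedBall_two_mul hM) hR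

theorem norm_sub_le_of_bound (hd : DifferentiableOn ℂ f (ball x R))
    (hM : ∀ y ∈ ball x R, ‖f y‖ ≤ M) (hy : y ∈ ball x R) :
    ‖f y - f x‖ ≤ 2 * M / R * ‖y - x‖ := by
  simpa [dist_eq_norm] using
    Complex.dist_le_div_mul_dist_of_mapsTo_ball hd (mapsTo_closedBall_two_mul hM) hy

/-- A Taylor estimate with a remainder that depends only on a bound for the map: the Schwarz lemma
for maps that vanish to second order. -/
theorem norm_sub_sub_fderiv_le (hd : DifferentiableOn ℂ f (ball x R))
    (hM : ∀ y ∈ ball x R, ‖f y‖ ≤ M) (hy : y ∈ ball x R) :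
    ‖f y - f x - fderiv ℂ f x (y - x)‖ ≤ 4 * M / R ^ 2 * ‖y - x‖ ^ 2 := by
  have hR : 0 < R := pos_of_mem_ball hy
  have hM0 : 0 ≤ M := (norm_nonneg _).trans (hM y hy)
  set g : E → F := fun z => f z - fderiv ℂ f x (z - x) with hg
  have hgx : g x = f x := by simp [hg]
  have hgd : DifferentiableOn ℂ g (ball x R) :=
    hd.sub ((fderiv ℂ f x).differentiable.comp (differentiable_id.sub_const x)).differentiableOn
  have hmaps : MapsTo g (ball x R) (closedBall (g x) (4 * M)) := by
    intro z hz
    have h1 := norm_sub_le_of_bound hd hM hz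
    have h2 := (fderiv ℂ f x).le_of_opNorm_le (norm_fderiv_le_of_bound hR hd hM) (z - x)
    have h3 : ‖z - x‖ < R := by simpa [dist_eq_norm] using hz
    have h4 : 2 * M / R * ‖z - x‖ ≤ 2 * M := by
      rw [div_mul_eq_mul_div, div_le_iff₀ hR]; gcongr
    rw [mem_closedBall, dist_eq_norm, hgx]
    have : g z - f x = (f z - f x) - fderiv ℂ f x (z - x) := by simp only [hg]; abel
    rw [this]
    linarith [norm_sub_le (f z - f x) (fderiv ℂ f x (z - x))]
  have ho : (g · - g x) =o[𝓝 x] (fun w ↦ ‖w - x‖ ^ 1) := by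
    have h := (hd.differentiableAt (ball_mem_nhds x hR)).hasFDerivAt.isLittleO
    simp only [pow_one]
    refine h.norm_right.congr_left fun z => ?_
    rw [hgx]; simp only [hg]; abel
  have h := Complex.dist_le_mul_div_pow_of_mapsTo_ball_of_isLittleO hgd hmaps ho hy
  have e : g y - g x = f y - f x - fderiv ℂ f x (y - x) := by rw [hgx]; simp only [hg]; abel
  rw [dist_eq_norm, dist_eq_norm, e] at h
  refine h.trans_eq ?_
  rw [div_pow]; ring

theorem differentiableOn_clm_of_apply [FiniteDimensional ℂ E] {E' : Type*} [NormedAddCommGroup E']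
    [NormedSpace ℂ E']
    {A : E' → E →L[ℂ] F} {s : Set E'} (h : ∀ v, DifferentiableOn ℂ (fun x => A x v) s) :
    DifferentiableOn ℂ A s := by
  let d := Module.finrank ℂ E
  have hd : d = Module.finrank ℂ (Fin d → ℂ) := (Module.finrank_fin_fun ℂ).symm
  let e₁ := ContinuousLinearEquiv.ofFinrankEq hd
  let e₂ := (e₁.arrowCongr (1 : F ≃L[ℂ] F)).trans (ContinuousLinearEquiv.piRing (Fin d))
  rw [← Function.id_comp A, ← e₂.symm_comp_self]
  exact e₂.symm.differentiable.comp_differentiableOn (differentiableOn_pi.2 fun i => h _)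

variable [FiniteDimensional ℂ E] [FiniteDimensional ℂ F]

theorem differentiableAt_of_tendsto_ultrafilter {ι : Type*} (l : Ultrafilter ι) {f : ι → E → F}
    {g : E → F} (hR : 0 < R) (hd : ∀ᶠ i in l, DifferentiableOn ℂ (f i) (ball x R))
    (hM : ∀ᶠ i in l, ∀ y ∈ ball x R, ‖f i y‖ ≤ M)
    (hlim : ∀ y ∈ ball x R, Tendsto (f · y) l (𝓝 (g y))) :
    DifferentiableAt ℂ g x := by
  have : ProperSpace (E →L[ℂ] F) := FiniteDimensional.proper ℂ _
  obtain ⟨A, -, hA⟩ : ∃ A ∈ closedBall (0 : E →L[ℂ] F) (2 * M / R),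
      Tendsto (fun i => fderiv ℂ (f i) x) l (𝓝 A) := by
    refine (isCompact_closedBall _ _).ultrafilter_le_nhds' (l.map fun i => fderiv ℂ (f i) x) ?_
    change ∀ᶠ i in (l : Filter ι), _
    filter_upwards [hd, hM] with i h1 h2
    simpa using norm_fderiv_le_of_bound hR h1 h2
  refine HasFDerivAt.differentiableAt (f' := A) ?_
  rw [hasFDerivAt_iff_isLittleO]
  have hO : (fun y => g y - g x - A (y - x)) =O[𝓝 x] fun y => ‖y - x‖ ^ 2 := by
    refine Asymptotics.IsBigO.of_bound (4 * M / R ^ 2) ?_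
    filter_upwards [ball_mem_nhds x hR] with y hy
    have ht : Tendsto (fun i => ‖f i y - f i x - fderiv ℂ (f i) x (y - x)‖) l
        (𝓝 ‖g y - g x - A (y - x)‖) :=
      (((hlim y hy).sub (hlim x (mem_ball_self hR))).sub
        (((ContinuousLinearMap.apply ℂ F (y - x)).continuous.tendsto A).comp hA)).norm
    rw [norm_pow, norm_norm]
    refine le_of_tendsto ht ?_
    filter_upwards [hd, hM] with i h1 h2
    exact norm_sub_sub_fderiv_le h1 h2 hy
  refine hO.trans_isLittleO ?_
  have : (fun y : E => ‖y - x‖ ^ 2) =o[𝓝 x] fun y => ‖y - x‖ ^ 1 :=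
    (Asymptotics.isLittleO_pow_pow one_lt_two).comp_tendsto
      (by simpa using! (continuous_id.sub (continuous_const (y := x))).norm.tendsto x)
  simpa using this.norm_right

/-- Pointwise limits of uniformly bounded holomorphic maps are holomorphic: the remainder in
`norm_sub_sub_fderiv_le` is uniform, so no locally uniform convergence has to be established. -/
theorem differentiableAt_of_tendsto {ι : Type*} (l : Filter ι) [l.NeBot] {f : ι → E → F}
    {g : E → F} (hR : 0 < R) (hd : ∀ᶠ i in l, DifferentiableOn ℂ (f i) (ball x R))
    (hM : ∀ᶠ i in l, ∀ y ∈ ball x R, ‖f i y‖ ≤ M)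
    (hlim : ∀ y ∈ ball x R, Tendsto (f · y) l (𝓝 (g y))) : DifferentiableAt ℂ g x := by
  have hle : (Ultrafilter.of l : Filter ι) ≤ l := Ultrafilter.of_le l
  exact differentiableAt_of_tendsto_ultrafilter (Ultrafilter.of l) hR
    (hd.filter_mono hle) (hM.filter_mono hle) fun y hy => (hlim y hy).mono_left hle

/-- The derivative of a holomorphic map of several variables is holomorphic. -/
theorem DifferentiableOn.fderiv_of_isOpen {U : Set E} (hU : IsOpen U)
    (hf : DifferentiableOn ℂ f U) : DifferentiableOn ℂ (fderiv ℂ f) U := by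
  refine differentiableOn_clm_of_apply fun v x hx => ?_
  refine DifferentiableAt.differentiableWithinAt ?_
  obtain ⟨M, R, hR, hM, hRU⟩ : ∃ M R, 0 < R ∧ (∀ y ∈ ball x R, ‖f y‖ ≤ M) ∧ ball x R ⊆ U := by
    have h1 : ∀ᶠ y in 𝓝 x, ‖f y‖ < ‖f x‖ + 1 :=
      (hf.continuousOn.continuousAt (hU.mem_nhds hx)).norm.eventually_lt
        continuousAt_const (by simp)
    obtain ⟨R, hR, h⟩ := Metric.mem_nhds_iff.1 (h1.and (hU.mem_nhds hx))
    exact ⟨‖f x‖ + 1, R, hR, fun y hy => (h hy).1.le, fun y hy => (h hy).2⟩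
  have ht : ∀ᶠ t : ℂ in 𝓝[≠] 0, ‖t • v‖ < R / 4 := by
    refine (Filter.Tendsto.eventually_lt_const (v := ‖(0 : ℂ) • v‖) (by simpa using hR) ?_)
    exact ((continuous_id.smul continuous_const).norm.tendsto _).mono_left nhdsWithin_le_nhds
  -- the difference quotients in the direction `v` are uniformly bounded and converge pointwise
  refine differentiableAt_of_tendsto (R := R / 4) (M := 2 * M / (R / 2) * ‖v‖) (𝓝[≠] (0 : ℂ))
    (f := fun t y => t⁻¹ • (f (y + t • v) - f y)) (by positivity) ?_ ?_ ?_
  · filter_upwards [ht] with t ht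
    refine DifferentiableOn.const_smul (DifferentiableOn.sub ?_ ?_) _
    · refine hf.comp (by fun_prop) fun y hy => hRU ?_
      rw [mem_ball, dist_eq_norm] at hy ⊢
      have := norm_add_le (y - x) (t • v)
      rw [show y + t • v - x = y - x + t • v by abel]
      linarith
    · exact hf.mono fun y hy => hRU (ball_subset_ball (by linarith) hy)
  · filter_upwards [ht, self_mem_nhdsWithin] with t ht ht0 y hy
    have hsub : ball y (R / 2) ⊆ ball x R := fun z hz => by
      rw [mem_ball] at *; linarith [dist_triangle z y x]
    have h := norm_sub_le_of_bound (hf.mono (hsub.trans hRU)) (fun z hz => hM z (hsub hz))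
      (y := y + t • v) (by rw [mem_ball, dist_eq_norm, add_sub_cancel_left]; linarith)
    rw [add_sub_cancel_left, norm_smul] at h
    rw [norm_smul, norm_inv, inv_mul_le_iff₀ (norm_pos_iff.2 ht0)]
    linarith
  · intro y hy
    have hyU : y ∈ U := hRU (ball_subset_ball (by linarith) hy)
    have h := (hf.differentiableAt (hU.mem_nhds hyU)).hasFDerivAt.hasLineDerivAt v
    simpa using h.tendsto_slope_zero

theorem DifferentiableOn.contDiffOn_one {U : Set E} (hU : IsOpen U)
    (hf : DifferentiableOn ℂ f U) : ContDiffOn ℂ 1 f U := by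
  rw [← zero_add (1 : WithTop ℕ∞), contDiffOn_succ_iff_fderiv_of_isOpen hU]
  exact ⟨hf, by simp, contDiffOn_zero.2 (hf.fderiv_of_isOpen hU).continuousOn⟩

theorem DifferentiableOn.contDiffAt_one {U : Set E} (hU : IsOpen U)
    (hf : DifferentiableOn ℂ f U) (hx : x ∈ U) : ContDiffAt ℂ 1 f x :=
  (hf.contDiffOn_one hU).contDiffAt (hU.mem_nhds hx)

theorem DifferentiableOn.hasStrictFDerivAt {U : Set E} (hU : IsOpen U)
    (hf : DifferentiableOn ℂ f U) (hx : x ∈ U) : HasStrictFDerivAt f (fderiv ℂ f x) x :=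
  (hf.contDiffAt_one hU hx).hasStrictFDerivAt (by simp)

end HolomorphicMaps

/-! ### Persistence of zeros and maps whose derivative vanishes on a zero set -/

section Osgood

/-- **Hurwitz' theorem**, in the form of persistence of zeros: if `φ s₀` has a zero at the centre
of a disc and none on its boundary, then `φ s` has a zero in the disc for `s` near `s₀`. -/
theorem eventually_exists_zero {X : Type*} [TopologicalSpace X] {φ : X → ℂ → ℂ} {s₀ : X} {t₀ : ℂ}
    {ε : ℝ} (hε : 0 < ε) (hd : ∀ᶠ s in 𝓝 s₀, DiffContOnCl ℂ (φ s) (ball t₀ ε))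
    (hc : ∀ t ∈ sphere t₀ ε, ContinuousAt (fun p : X × ℂ => φ p.1 p.2) (s₀, t))
    (hne : ∀ t ∈ sphere t₀ ε, φ s₀ t ≠ 0) (h0 : Tendsto (fun s => φ s t₀) (𝓝 s₀) (𝓝 0)) :
    ∀ᶠ s in 𝓝 s₀, ∃ t ∈ closedBall t₀ ε, φ s t = 0 := by
  obtain ⟨c, hc0, hcs⟩ : ∃ c > 0, ∀ t ∈ sphere t₀ ε, c < ‖φ s₀ t‖ := by
    have hcont : ContinuousOn (fun t => ‖φ s₀ t‖) (sphere t₀ ε) := fun t ht =>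
      (ContinuousAt.comp (f := fun t : ℂ => (s₀, t)) (hc t ht)
        (by fun_prop)).norm.continuousWithinAt
    obtain ⟨t, ht, hmin⟩ := (isCompact_sphere t₀ ε).exists_isMinOn
      (NormedSpace.sphere_nonempty.2 hε.le) hcont
    have hpos : 0 < ‖φ s₀ t‖ := norm_pos_iff.2 (hne t ht)
    exact ⟨‖φ s₀ t‖ / 2, half_pos hpos, fun t' ht' => (half_lt_self hpos).trans_le (hmin ht')⟩
  have hs : ∀ᶠ s in 𝓝 s₀, ∀ t ∈ sphere t₀ ε, c < ‖φ s t‖ :=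
    (isCompact_sphere t₀ ε).eventually_forall_of_forall_eventually fun t ht =>
      (hc t ht).norm.eventually_const_lt (hcs t ht)
  have h0' : ∀ᶠ s in 𝓝 s₀, ‖φ s t₀‖ < c :=
    h0.norm.eventually_lt_const (by simpa using hc0)
  filter_upwards [hd, hs, h0'] with s hd hs h0
  by_contra! h
  -- without zeros the maximum principle applies to `1 / φ s`
  have hcl : closure (ball t₀ ε) = closedBall t₀ ε := closure_ball t₀ hε.ne'
  have hinv : DiffContOnCl ℂ (φ s)⁻¹ (ball t₀ ε) := hd.inv fun t ht => h t (hcl ▸ ht)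
  have hle := Complex.norm_le_of_forall_mem_frontier_norm_le isBounded_ball hinv (C := c⁻¹)
    (fun t ht => by
      rw [frontier_ball t₀ hε.ne'] at ht
      rw [Pi.inv_apply, norm_inv]
      exact inv_anti₀ hc0 (hs t ht).le) (subset_closure (mem_ball_self hε))
  rw [Pi.inv_apply, norm_inv,
    inv_le_inv₀ (norm_pos_iff.2 (h t₀ (mem_closedBall_self hε.le))) hc0] at hle
  exact absurd hle (not_le.2 h0)

theorem dslope_swap {E : Type*} [NormedAddCommGroup E] [NormedSpace ℂ E] (f : ℂ → E) (a b : ℂ) :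
    dslope f a b = dslope f b a := by
  rcases eq_or_ne a b with rfl | h
  · rfl
  · rw [dslope_of_ne f h.symm, dslope_of_ne f h, slope_comm]

/-- If the derivative vanishes at `q`, then so does the difference quotient, as a function of two
variables, at `(q, q)`. By injectivity its other zeros lie on the diagonal, and they persist by
Hurwitz' theorem, so that the derivative vanishes near `q`. -/
theorem deriv_ne_zero_of_injOn {f : ℂ → ℂ} {U : Set ℂ} (hU : IsOpen U)
    (hf : DifferentiableOn ℂ f U) (hinj : InjOn f U) {q : ℂ} (hq : q ∈ U) : deriv f q ≠ 0 := by
  intro hq0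
  obtain ⟨R, hR, hRU⟩ := Metric.isOpen_iff.1 hU q hq
  have hsub : closedBall q (R / 2) ⊆ U :=
    (closedBall_subset_ball (by linarith)).trans hRU
  have hfq : DifferentiableAt ℂ f q := hf.differentiableAt (hU.mem_nhds hq)
  have hdq : dslope f q q = 0 := by rw [dslope_same, hq0]
  have hz : ∀ᶠ s in 𝓝 q, ∃ t ∈ closedBall q (R / 2), dslope f s t = 0 := by
    refine eventually_exists_zero (by positivity) ?_ ?_ ?_ ?_
    · filter_upwards [hU.mem_nhds hq] with s hs
      refine DifferentiableOn.diffContOnCl ?_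
      rw [closure_ball q (by positivity)]
      exact ((Complex.differentiableOn_dslope (hU.mem_nhds hs)).2 hf).mono hsub
    · intro t ht
      have htq : t ≠ q := ne_of_mem_sphere ht (by positivity)
      have hft : ContinuousAt f t :=
        (hf.differentiableAt (hU.mem_nhds (hsub (sphere_subset_closedBall ht)))).continuousAt
      have hcont : ContinuousAt (fun p : ℂ × ℂ => (f p.2 - f p.1) / (p.2 - p.1)) (q, t) := by
        refine ContinuousAt.div ?_ (by fun_prop) (sub_ne_zero.2 htq)
        exact (ContinuousAt.comp (f := Prod.snd) (by exact hft) continuousAt_snd).sub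
          (ContinuousAt.comp (f := Prod.fst) (by exact hfq.continuousAt) continuousAt_fst)
      refine hcont.congr ?_
      have : ∀ᶠ p : ℂ × ℂ in 𝓝 (q, t), p.2 ≠ p.1 :=
        continuousAt_snd.ne_iff_eventually_ne continuousAt_fst |>.1 htq
      filter_upwards [this] with p hp
      rw [dslope_of_ne f hp, slope_def_field]
    · intro t ht h
      have htq : t ≠ q := ne_of_mem_sphere ht (by positivity)
      rw [dslope_of_ne f htq, slope_def_field, div_eq_zero_iff] at h
      rcases h with h | h
      · exact htq (hinj (hsub (sphere_subset_closedBall ht)) hq (sub_eq_zero.1 h))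
      · exact htq (sub_eq_zero.1 h)
    · have := (continuousAt_dslope_same.2 hfq).tendsto
      rw [hdq] at this
      exact this.congr fun s => dslope_swap f q s
  have hder : ∀ᶠ s in 𝓝 q, deriv f s = 0 := by
    filter_upwards [hz, hU.mem_nhds hq] with s ⟨t, ht, hst⟩ hs
    rcases eq_or_ne t s with rfl | hts
    · rwa [dslope_same] at hst
    · rw [dslope_of_ne f hts, slope_def_field, div_eq_zero_iff] at hst
      rcases hst with h | h
      · exact absurd (hinj (hsub ht) hs (sub_eq_zero.1 h)) hts
      · exact absurd (sub_eq_zero.1 h) hts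
  obtain ⟨δ, hδ, hδ'⟩ := Metric.mem_nhds_iff.1 (hder.and (hU.mem_nhds hq))
  have hmem : q + (δ / 2 : ℝ) ∈ ball q δ := by
    rw [mem_ball, dist_eq_norm, add_sub_cancel_left, Complex.norm_real, Real.norm_eq_abs,
      abs_of_pos (by positivity)]
    linarith
  have heq := isOpen_ball.is_const_of_deriv_eq_zero (convex_ball q δ).isPreconnected
    (hf.mono fun s hs => (hδ' hs).2) (fun s hs => (hδ' hs).1) hmem (mem_ball_self hδ)
  have := hinj (hδ' hmem).2 hq heq
  rw [add_eq_left, Complex.ofReal_eq_zero] at this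
  linarith

/-- The `k`-th partial derivative in the second variable. -/
noncomputable def iteratedPartialSnd (j : ℂ × ℂ → ℂ) (k : ℕ) : ℂ × ℂ → ℂ :=
  (fun u p => fderiv ℂ u p (0, 1))^[k] j

theorem iteratedPartialSnd_succ (j : ℂ × ℂ → ℂ) (k : ℕ) (p : ℂ × ℂ) :
    iteratedPartialSnd j (k + 1) p = fderiv ℂ (iteratedPartialSnd j k) p (0, 1) := by
  simp only [iteratedPartialSnd, Function.iterate_succ_apply']

theorem differentiableOn_iteratedPartialSnd {Ω : Set (ℂ × ℂ)} (hΩ : IsOpen Ω) {j : ℂ × ℂ → ℂ}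
    (hj : DifferentiableOn ℂ j Ω) (k : ℕ) : DifferentiableOn ℂ (iteratedPartialSnd j k) Ω := by
  induction k with
  | zero => exact hj
  | succ k ih =>
    refine DifferentiableOn.congr (f := fun p => fderiv ℂ (iteratedPartialSnd j k) p (0, 1)) ?_
      fun p _ => iteratedPartialSnd_succ j k p
    exact (ih.fderiv_of_isOpen hΩ).clm_apply (differentiableOn_const _)

/-- A holomorphic map of two variables whose derivative vanishes on the zero set of a holomorphic
function `j` is not injective, if `j` has a zero at which it does not vanish to infinite order in
the second variable. Near a zero where that order is minimal the zero set is the graph of a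
holomorphic function, and the map is constant along this graph. -/
theorem not_injOn_of_fderiv_eq_zero_on_zeros {F : Type*} [NormedAddCommGroup F] [NormedSpace ℂ F]
    {Ω : Set (ℂ × ℂ)} (hΩ : IsOpen Ω) {j : ℂ × ℂ → ℂ} (hj : DifferentiableOn ℂ j Ω)
    {h : ℂ × ℂ → F} (hh : DifferentiableOn ℂ h Ω)
    (hjh : ∀ p ∈ Ω, j p = 0 → fderiv ℂ h p = 0) {p₀ : ℂ × ℂ} (hp₀ : p₀ ∈ Ω) (hjp₀ : j p₀ = 0)
    (hk : ∃ k, iteratedPartialSnd j k p₀ ≠ 0) : ¬ InjOn h Ω := by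
  classical
  intro hinj
  have hex : ∃ k, ∃ p ∈ Ω, j p = 0 ∧ iteratedPartialSnd j k p ≠ 0 :=
    hk.imp fun k hk => ⟨p₀, hp₀, hjp₀, hk⟩
  obtain ⟨m, hm, hmin⟩ : ∃ m, (∃ p ∈ Ω, j p = 0 ∧ iteratedPartialSnd j m p ≠ 0) ∧
      ∀ k < m, ∀ p ∈ Ω, j p = 0 → iteratedPartialSnd j k p = 0 := by
    refine ⟨Nat.find hex, Nat.find_spec hex, fun k hk p hp hjp => ?_⟩
    have := Nat.find_min hex hk
    push Not at this
    exact this p hp hjp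
  obtain ⟨⟨s₁, t₁⟩, hpΩ, hjp, hmp⟩ := hm
  obtain _ | k := m
  · exact hmp hjp
  set G := iteratedPartialSnd j k with hG
  have hG0 : ∀ p ∈ Ω, j p = 0 → G p = 0 := hmin k (Nat.lt_succ_self k)
  rw [iteratedPartialSnd_succ] at hmp
  have hGd : ContDiffAt ℂ 1 G (s₁, t₁) :=
    (differentiableOn_iteratedPartialSnd hΩ hj k).contDiffAt_one hΩ hpΩ
  have hinv : (fderiv ℂ G (s₁, t₁) ∘L .inr ℂ ℂ ℂ).IsInvertible := by
    refine ⟨ContinuousLinearEquiv.unitsEquivAut ℂ (Units.mk0 _ hmp), ?_⟩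
    ext
    simp [hG]
  set τ := hGd.implicitFunction one_ne_zero hinv with hτ
  have hiff : ∀ᶠ p in 𝓝 (s₁, t₁), G p = G (s₁, t₁) ↔ τ p.1 = p.2 :=
    hGd.eventually_apply_eq_iff_implicitFunction one_ne_zero hinv
  have hGp : G (s₁, t₁) = 0 := hG0 _ hpΩ hjp
  have hτ₁ : τ s₁ = t₁ := hGd.implicitFunction_apply_self one_ne_zero hinv
  have hτd : ∀ᶠ s in 𝓝 s₁, DifferentiableAt ℂ τ s := by
    have hc : ContDiffAt ℂ 1 τ s₁ := hGd.contDiffAt_implicitFunction one_ne_zero hinv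
    filter_upwards [hc.eventually (by simp)] with s hs
    exact hs.differentiableAt one_ne_zero
  obtain ⟨ε, hε, hεΩ⟩ := Metric.mem_nhds_iff.1 (hiff.and (hΩ.mem_nhds hpΩ))
  have hmem : ∀ s ∈ ball s₁ ε, ∀ t ∈ closedBall t₁ (ε / 2), (s, t) ∈ ball (s₁, t₁) ε := by
    intro s hs t ht
    rw [← ball_prod_same]
    exact ⟨hs, closedBall_subset_ball (by linarith) ht⟩
  have hgraph : ∀ s ∈ ball s₁ ε, ∀ t ∈ closedBall t₁ (ε / 2), j (s, t) = 0 → τ s = t := by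
    intro s hs t ht hst
    have := hεΩ (hmem s hs t ht)
    exact this.1.1 ((hG0 _ this.2 hst).trans hGp.symm)
  have hzero : ∀ᶠ s in 𝓝 s₁, ∃ t ∈ closedBall t₁ (ε / 2), j (s, t) = 0 := by
    refine eventually_exists_zero (φ := fun s t => j (s, t)) (by positivity) ?_ ?_ ?_ ?_
    · filter_upwards [ball_mem_nhds s₁ hε] with s hs
      refine DifferentiableOn.diffContOnCl ?_
      rw [closure_ball t₁ (by positivity)]
      exact hj.comp (by fun_prop) fun t ht => (hεΩ (hmem s hs t ht)).2
    · intro t ht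
      exact (hj.differentiableAt (hΩ.mem_nhds (hεΩ (hmem s₁ (mem_ball_self hε) t
        (sphere_subset_closedBall ht))).2)).continuousAt
    · intro t ht h0
      have := hgraph s₁ (mem_ball_self hε) t (sphere_subset_closedBall ht) h0
      exact ne_of_mem_sphere ht (by positivity) (this.symm.trans hτ₁)
    · have hc : ContinuousAt j (s₁, t₁) := (hj.differentiableAt (hΩ.mem_nhds hpΩ)).continuousAt
      have := ContinuousAt.comp (f := fun s : ℂ => (s, t₁)) (x := s₁) hc (by fun_prop)
      simpa only [ContinuousAt, Function.comp_def, hjp] using this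
  obtain ⟨δ, hδ, hδ'⟩ := Metric.mem_nhds_iff.1
    ((hzero.and hτd).and (ball_mem_nhds s₁ hε))
  have hcurve : ∀ s ∈ ball s₁ δ, (s, τ s) ∈ Ω ∧ j (s, τ s) = 0 := by
    intro s hs
    obtain ⟨⟨⟨t, ht, hst⟩, -⟩, hsε⟩ := hδ' hs
    rw [hgraph s hsε t ht hst]
    exact ⟨(hεΩ (hmem s hsε t ht)).2, hst⟩
  have hderiv : ∀ s ∈ ball s₁ δ, HasDerivAt (fun s => h (s, τ s)) 0 s := by
    intro s hs
    have h1 := (hh.differentiableAt (hΩ.mem_nhds (hcurve s hs).1)).hasFDerivAt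
    rw [hjh _ (hcurve s hs).1 (hcurve s hs).2] at h1
    have h2 : HasDerivAt (fun s => (s, τ s)) (1, deriv τ s) s :=
      (hasDerivAt_id s).prodMk (hδ' hs).1.2.hasDerivAt
    simpa [Function.comp_def] using h1.comp_hasDerivAt s h2
  have hmem' : s₁ + (δ / 2 : ℝ) ∈ ball s₁ δ := by
    rw [mem_ball, dist_eq_norm, add_sub_cancel_left, Complex.norm_real, Real.norm_eq_abs,
      abs_of_pos (by positivity)]
    linarith
  have heq := isOpen_ball.is_const_of_deriv_eq_zero (convex_ball s₁ δ).isPreconnected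
    (fun s hs => (hderiv s hs).differentiableAt.differentiableWithinAt)
    (fun s hs => (hderiv s hs).deriv) hmem' (mem_ball_self hδ)
  have := hinj (hcurve _ hmem').1 (hcurve _ (mem_ball_self hδ)).1 heq
  rw [Prod.mk.injEq, add_eq_left, Complex.ofReal_eq_zero] at this
  linarith [this.1]

theorem exists_iteratedPartialSnd_ne_zero {Ω : Set (ℂ × ℂ)} (hΩ : IsOpen Ω) {j : ℂ × ℂ → ℂ}
    (hj : DifferentiableOn ℂ j Ω) {s₀ t₀ t₁ : ℂ} {R : ℝ} (ht₁ : t₁ ∈ ball t₀ R)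
    (hR : ∀ t ∈ ball t₀ R, (s₀, t) ∈ Ω) (hne : j (s₀, t₁) ≠ 0) :
    ∃ k, iteratedPartialSnd j k (s₀, t₀) ≠ 0 := by
  by_contra! h
  have hit : ∀ k, ∀ t ∈ ball t₀ R,
      iteratedDeriv k (fun t => j (s₀, t)) t = iteratedPartialSnd j k (s₀, t) := by
    intro k
    induction k with
    | zero => intro t _; simp [iteratedPartialSnd]
    | succ k ih =>
      intro t ht
      have he : iteratedDeriv k (fun t => j (s₀, t)) =ᶠ[𝓝 t]
          fun t => iteratedPartialSnd j k (s₀, t) := by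
        filter_upwards [isOpen_ball.mem_nhds ht] with t' ht' using ih t' ht'
      rw [iteratedDeriv_succ, he.deriv_eq, iteratedPartialSnd_succ]
      have h1 := ((differentiableOn_iteratedPartialSnd hΩ hj k).differentiableAt
        (hΩ.mem_nhds (hR t ht))).hasFDerivAt
      exact (h1.comp_hasDerivAt t ((hasDerivAt_const t s₀).prodMk (hasDerivAt_id t))).deriv
  have hd : DifferentiableOn ℂ (fun t => j (s₀, t)) (ball t₀ R) := hj.comp (by fun_prop) hR
  have := Complex.taylorSeries_eq_on_ball' ht₁ hd
  refine hne (this.symm.trans ?_)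
  simp [hit _ t₀ (mem_ball_self (pos_of_mem_ball ht₁)), h]

end Osgood

/-! ### Osgood's theorem on injective holomorphic maps -/

section OsgoodTheorem

/-- A functional `l` with `l v = 1` splits the space as `ℂ v ⊕ ker l`. -/
theorem exists_equiv_prod_ker {E : Type*} [NormedAddCommGroup E] [NormedSpace ℂ E]
    (l : E →L[ℂ] ℂ) {v : E} (hv : l v = 1) :
    ∃ e : E ≃L[ℂ] ℂ × LinearMap.ker (l : E →ₗ[ℂ] ℂ), (∀ x, (e x).1 = l x) ∧
      ∀ w : LinearMap.ker (l : E →ₗ[ℂ] ℂ), e.symm (0, w) = w := by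
  let π : E →L[ℂ] LinearMap.ker (l : E →ₗ[ℂ] ℂ) :=
    (ContinuousLinearMap.id ℂ E - l.smulRight v).codRestrict _ fun x => by simp [hv]
  have hπ : ∀ x, (π x : E) = x - l x • v := fun x => rfl
  refine ⟨ContinuousLinearEquiv.equivOfInverse (l.prod π)
    ((ContinuousLinearMap.toSpanSingleton ℂ v).coprod
      (LinearMap.ker (l : E →ₗ[ℂ] ℂ)).subtypeL) ?_ ?_, fun x => rfl, fun w => ?_⟩
  · intro x
    simp [hπ]
  · rintro ⟨c, w⟩
    have hw : l w = 0 := w.2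
    ext
    · simp [hv, hw]
    · simp [hπ, hv, hw]
  · simp

theorem finrank_ker_of_equiv_prod {E : Type*} [NormedAddCommGroup E] [NormedSpace ℂ E]
    [FiniteDimensional ℂ E] {l : E →L[ℂ] ℂ} {n : ℕ} (hn : Module.finrank ℂ E = n + 1)
    (e : E ≃L[ℂ] ℂ × LinearMap.ker (l : E →ₗ[ℂ] ℂ)) :
    Module.finrank ℂ (LinearMap.ker (l : E →ₗ[ℂ] ℂ)) = n := by
  have := e.toLinearEquiv.finrank_eq
  rw [Module.finrank_prod, Module.finrank_self] at this
  omega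

variable {E F : Type*} [NormedAddCommGroup E] [NormedSpace ℂ E] [NormedAddCommGroup F]
  [NormedSpace ℂ F] [FiniteDimensional ℂ E] [FiniteDimensional ℂ F] {f : E → F} {U : Set E}

/-- The inductive step of Osgood's theorem at a point where the derivative is not zero: restrict
to a level set of a coordinate with non-zero derivative, which is a manifold of one dimension
less. -/
theorem injective_fderiv_of_fderiv_ne_zero {n : ℕ}
    (ih : ∀ (E' : Submodule ℂ E) (F' : Submodule ℂ F), Module.finrank ℂ E' = n →
      Module.finrank ℂ F' = n → ∀ (g : E' → F') (V : Set E'), IsOpen V → DifferentiableOn ℂ g V →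
      InjOn g V → ∀ x ∈ V, Function.Injective (fderiv ℂ g x))
    (hE : Module.finrank ℂ E = n + 1) (hF : Module.finrank ℂ F = n + 1) (hU : IsOpen U)
    (hf : DifferentiableOn ℂ f U) (hinj : InjOn f U) {q : E} (hq : q ∈ U)
    (hne : fderiv ℂ f q ≠ 0) : Function.Injective (fderiv ℂ f q) := by
  obtain ⟨v, hv⟩ : ∃ v, fderiv ℂ f q v ≠ 0 := by
    by_contra! h
    exact hne (ContinuousLinearMap.ext h)
  obtain ⟨m, hm⟩ := SeparatingDual.exists_eq_one (R := ℂ) hv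
  set l : E →L[ℂ] ℂ := m ∘L fderiv ℂ f q with hl
  obtain ⟨e, he1, he2⟩ := exists_equiv_prod_ker l (v := v) hm
  obtain ⟨e', he1', he2'⟩ := exists_equiv_prod_ker m hm
  -- straighten the level sets of `m ∘ f` near `q`
  set Φ : E → ℂ × LinearMap.ker (l : E →ₗ[ℂ] ℂ) := fun x => (m (f x), (e x).2) with hΦ
  have hΦd : HasFDerivAt Φ (e : E →L[ℂ] ℂ × LinearMap.ker (l : E →ₗ[ℂ] ℂ)) q := by
    have h1 := m.hasFDerivAt.comp q (hf.differentiableAt (hU.mem_nhds hq)).hasFDerivAt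
    have h2 : HasFDerivAt (fun x => (e x).2) ((ContinuousLinearMap.snd ℂ _ _) ∘L
      (e : E →L[ℂ] ℂ × LinearMap.ker (l : E →ₗ[ℂ] ℂ))) q :=
      ((ContinuousLinearMap.snd ℂ _ _) ∘L
        (e : E →L[ℂ] ℂ × LinearMap.ker (l : E →ₗ[ℂ] ℂ))).hasFDerivAt
    refine (h1.prodMk h2).congr_fderiv ?_
    ext x
    · exact (he1 x).symm
    · rfl
  have hΦc : ContDiffAt ℂ 1 Φ q := by
    refine ContDiffAt.prodMk (m.contDiff.contDiffAt.comp q (hf.contDiffAt_one hU hq)) ?_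
    exact ((ContinuousLinearMap.snd ℂ _ _) ∘L
      (e : E →L[ℂ] ℂ × LinearMap.ker (l : E →ₗ[ℂ] ℂ))).contDiff.contDiffAt
  set Ψ := hΦc.localInverse hΦd one_ne_zero with hΨ
  have hs : HasStrictFDerivAt Φ (e : E →L[ℂ] ℂ × LinearMap.ker (l : E →ₗ[ℂ] ℂ)) q :=
    hΦc.hasStrictFDerivAt' hΦd one_ne_zero
  have hΨq : Ψ (Φ q) = q := hs.localInverse_apply_image
  have hΨd : HasFDerivAt Ψ
      (e.symm : ℂ × LinearMap.ker (l : E →ₗ[ℂ] ℂ) →L[ℂ] E) (Φ q) := hs.to_localInverse.hasFDerivAt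
  have hΨc : ContDiffAt ℂ 1 Ψ (Φ q) := hΦc.to_localInverse hΦd one_ne_zero
  have hev : ∀ᶠ p in 𝓝 (Φ q), Φ (Ψ p) = p ∧ DifferentiableAt ℂ Ψ p ∧ Ψ p ∈ U := by
    refine hs.eventually_right_inverse.and (Eventually.and ?_ ?_)
    · filter_upwards [hΨc.eventually (by simp)] with p hp
      exact hp.differentiableAt one_ne_zero
    · exact hΨd.continuousAt.eventually (by rw [hΨq]; exact hU.mem_nhds hq)
  obtain ⟨δ, hδ, hδ'⟩ := Metric.mem_nhds_iff.1 hev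
  set ι : LinearMap.ker (l : E →ₗ[ℂ] ℂ) → ℂ × LinearMap.ker (l : E →ₗ[ℂ] ℂ) :=
    fun w => (m (f q), w) with hι
  have hιd : ∀ w, HasFDerivAt ι (ContinuousLinearMap.inr ℂ ℂ _) w := fun w =>
    hasFDerivAt_prodMk_right _ _
  set w₀ := (e q).2 with hw₀
  have hιmem : ∀ w ∈ ball w₀ δ, ι w ∈ ball (Φ q) δ := by
    intro w hw
    rw [hΦ, ← ball_prod_same]
    exact ⟨mem_ball_self hδ, hw⟩
  set P : F →L[ℂ] LinearMap.ker (m : F →ₗ[ℂ] ℂ) := (ContinuousLinearMap.snd ℂ _ _) ∘L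
    (e' : F →L[ℂ] ℂ × LinearMap.ker (m : F →ₗ[ℂ] ℂ)) with hP
  set g := fun w => P (f (Ψ (ι w))) with hg
  have hgd : ∀ w ∈ ball w₀ δ, DifferentiableAt ℂ g w := by
    intro w hw
    obtain ⟨-, h2, h3⟩ := hδ' (hιmem w hw)
    exact P.differentiableAt.comp w ((hf.differentiableAt (hU.mem_nhds h3)).comp w
      (h2.comp w (hιd w).differentiableAt))
  have hmf : ∀ w ∈ ball w₀ δ, m (f (Ψ (ι w))) = m (f q) := fun w hw =>
    congrArg Prod.fst (hδ' (hιmem w hw)).1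
  have hginj : InjOn g (ball w₀ δ) := by
    intro w hw w' hw' hww
    have h1 : f (Ψ (ι w)) = f (Ψ (ι w')) := by
      refine e'.injective (Prod.ext ?_ hww)
      rw [he1', he1', hmf w hw, hmf w' hw']
    have h2 := hinj (hδ' (hιmem w hw)).2.2 (hδ' (hιmem w' hw')).2.2 h1
    have h3 := congrArg Φ h2
    rw [(hδ' (hιmem w hw)).1, (hδ' (hιmem w' hw')).1] at h3
    exact congrArg Prod.snd h3
  have hg' := ih _ _ (finrank_ker_of_equiv_prod hE e) (finrank_ker_of_equiv_prod hF e') g _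
    isOpen_ball (fun w hw => (hgd w hw).differentiableWithinAt) hginj w₀ (mem_ball_self hδ)
  have hgw : HasFDerivAt g (P ∘L fderiv ℂ f q ∘L
      (e.symm : ℂ × LinearMap.ker (l : E →ₗ[ℂ] ℂ) →L[ℂ] E) ∘L
      ContinuousLinearMap.inr ℂ ℂ _) w₀ := by
    have h1 : HasFDerivAt (fun w => Ψ (ι w)) ((e.symm : ℂ × LinearMap.ker (l : E →ₗ[ℂ] ℂ) →L[ℂ] E)
      ∘L ContinuousLinearMap.inr ℂ ℂ _) w₀ := HasFDerivAt.comp w₀ (by exact hΨd) (hιd w₀)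
    refine P.hasFDerivAt.comp w₀ (HasFDerivAt.comp w₀ ?_ h1)
    have : Ψ (ι w₀) = q := hΨq
    rw [this]
    exact (hf.differentiableAt (hU.mem_nhds hq)).hasFDerivAt
  rw [hgw.fderiv] at hg'
  rw [injective_iff_map_eq_zero]
  intro x hx
  have hlx : l x = 0 := by simp [hl, hx]
  have := (injective_iff_map_eq_zero _).1 hg' ⟨x, hlx⟩ (by simp [he2, hx])
  exact congrArg Subtype.val this

/-- The Jacobian determinant of a holomorphic map between spaces of the same dimension, in some
bases: a holomorphic function that vanishes where the derivative is not injective. -/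
theorem exists_differentiableOn_eq_zero_iff_not_injective_fderiv
    (hEF : Module.finrank ℂ E = Module.finrank ℂ F) (hU : IsOpen U)
    (hf : DifferentiableOn ℂ f U) :
    ∃ J : E → ℂ, DifferentiableOn ℂ J U ∧ ∀ x, J x = 0 ↔ ¬ Function.Injective (fderiv ℂ f x) := by
  let d := Module.finrank ℂ E
  have hd : d = Module.finrank ℂ (Fin d → ℂ) := (Module.finrank_fin_fun ℂ).symm
  let e : E ≃L[ℂ] (Fin d → ℂ) := ContinuousLinearEquiv.ofFinrankEq hd
  let e' : F ≃L[ℂ] (Fin d → ℂ) := ContinuousLinearEquiv.ofFinrankEq (hEF.symm.trans hd)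
  let L : E → (Fin d → ℂ) →ₗ[ℂ] (Fin d → ℂ) := fun x =>
    ((e' : F →L[ℂ] (Fin d → ℂ)) ∘L fderiv ℂ f x ∘L (e.symm : (Fin d → ℂ) →L[ℂ] E) :
      (Fin d → ℂ) →L[ℂ] (Fin d → ℂ))
  refine ⟨fun x => LinearMap.det (L x), ?_, fun x => ?_⟩
  · have h : ∀ x, LinearMap.det (L x) = ∑ σ : Equiv.Perm (Fin d), ((Equiv.Perm.sign σ : ℤ) : ℂ) *
        ∏ i, e' (fderiv ℂ f x (e.symm (Pi.single i 1))) (σ i) := by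
      intro x
      rw [← LinearMap.det_toMatrix', Matrix.det_apply']
      rfl
    simp_rw [h]
    refine DifferentiableOn.fun_sum fun σ _ => DifferentiableOn.const_mul ?_ _
    have h1 : ∀ i, DifferentiableOn ℂ
        (fun x => e' (fderiv ℂ f x (e.symm (Pi.single i 1))) (σ i)) U := fun i =>
      differentiableOn_pi.1 (e'.differentiable.comp_differentiableOn
        ((hf.fderiv_of_isOpen hU).clm_apply (differentiableOn_const _))) (σ i)
    have h2 : ∀ s : Finset (Fin d), DifferentiableOn ℂ
        (fun x => ∏ i ∈ s, e' (fderiv ℂ f x (e.symm (Pi.single i 1))) (σ i)) U := by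
      intro s
      induction s using Finset.induction_on with
      | empty => simp
      | insert i s hi ih =>
        simp_rw [Finset.prod_insert hi]
        exact (h1 i).mul ih
    exact h2 Finset.univ
  · have hLinj : Function.Injective (L x) ↔ Function.Injective (fderiv ℂ f x) := by
      change Function.Injective (e' ∘ fderiv ℂ f x ∘ e.symm) ↔ _
      rw [e'.injective.of_comp_iff]
      exact Function.Injective.of_comp_iff' _ e.symm.bijective
    change LinearMap.det (L x) = 0 ↔ _
    rw [← hLinj, ← LinearMap.ker_eq_bot, ← LinearMap.isUnit_iff_ker_eq_bot,
      LinearMap.isUnit_iff_isUnit_det, isUnit_iff_ne_zero, not_not]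

/-- The part of Osgood's theorem at points where the derivative vanishes, if it is known to be
invertible at all others. -/
theorem fderiv_ne_zero_of_injOn (hEF : Module.finrank ℂ E = Module.finrank ℂ F)
    (hE : 0 < Module.finrank ℂ E) (hU : IsOpen U) (hf : DifferentiableOn ℂ f U) (hinj : InjOn f U)
    (h : ∀ x ∈ U, fderiv ℂ f x ≠ 0 → Function.Injective (fderiv ℂ f x)) {q : E} (hq : q ∈ U) :
    fderiv ℂ f q ≠ 0 := by
  intro hq0
  have : Nontrivial E := Module.nontrivial_of_finrank_pos hE
  have hqd : HasFDerivAt f (0 : E →L[ℂ] F) q := by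
    rw [← hq0]; exact (hf.differentiableAt (hU.mem_nhds hq)).hasFDerivAt
  obtain h1 | h2 : Module.finrank ℂ E = 1 ∨ 1 < Module.finrank ℂ E := by omega
  · let e : E ≃L[ℂ] ℂ := ContinuousLinearEquiv.ofFinrankEq (h1.trans (Module.finrank_self ℂ).symm)
    let e' : F ≃L[ℂ] ℂ := ContinuousLinearEquiv.ofFinrankEq
      (hEF.symm.trans (h1.trans (Module.finrank_self ℂ).symm))
    have hV : IsOpen (e.symm ⁻¹' U) := hU.preimage e.symm.continuous
    refine deriv_ne_zero_of_injOn (f := fun z => e' (f (e.symm z))) hV ?_ ?_ (q := e q)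
      (by simpa using hq) ?_
    · exact e'.differentiable.comp_differentiableOn
        (hf.comp e.symm.differentiable.differentiableOn fun z hz => hz)
    · intro z hz w hw hzw
      exact e.symm.injective (hinj hz hw (e'.injective hzw))
    · have h3 : HasFDerivAt (fun z => f (e.symm z))
          ((0 : E →L[ℂ] F) ∘L (e.symm : ℂ →L[ℂ] E)) (e q) :=
        HasFDerivAt.comp (e q) (by simpa using hqd) e.symm.hasFDerivAt
      have h4 := e'.hasFDerivAt.comp_hasDerivAt (e q) h3.hasDerivAt
      simpa [Function.comp_def] using h4.deriv
  · obtain ⟨J, hJd, hJ⟩ := exists_differentiableOn_eq_zero_iff_not_injective_fderiv hEF hU hf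
    have hJ' : ∀ x ∈ U, J x = 0 ↔ fderiv ℂ f x = 0 := by
      intro x hx
      rw [hJ]
      refine ⟨fun hx' => not_not.1 fun h0 => hx' (h x hx h0), fun h0 => ?_⟩
      rw [h0]
      intro hi
      obtain ⟨v, hv⟩ := exists_ne (0 : E)
      exact hv (hi rfl)
    obtain ⟨R, hR, hRU⟩ := Metric.isOpen_iff.1 hU q hq
    obtain ⟨q₁, hq₁, hne⟩ : ∃ q₁ ∈ ball q R, fderiv ℂ f q₁ ≠ 0 := by
      by_contra! h0
      have hc := fun x hx => isOpen_ball.is_const_of_fderiv_eq_zero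
        (convex_ball q R).isPreconnected (hf.mono hRU) h0 (x := x) hx (mem_ball_self hR)
      obtain ⟨v, hv⟩ := exists_ne (0 : E)
      obtain ⟨t, ht, ht'⟩ : ∃ t : ℂ, t ≠ 0 ∧ q + t • v ∈ ball q R := by
        have hcont : ContinuousAt (fun t : ℂ => q + t • v) 0 := by fun_prop
        have hev : ∀ᶠ t : ℂ in 𝓝[≠] 0, q + t • v ∈ ball q R :=
          (hcont.eventually_mem (by simpa using ball_mem_nhds q hR)).filter_mono nhdsWithin_le_nhds
        obtain ⟨t, ht, ht0⟩ := (hev.and self_mem_nhdsWithin).exists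
        exact ⟨t, ht0, ht⟩
      have := hinj (hRU ht') hq (hc _ ht')
      rw [add_eq_left, smul_eq_zero] at this
      exact this.elim ht hv
    -- restrict to the complex plane through `q` and `q₁` in a further direction `a`
    have hb : q₁ - q ≠ 0 := by
      rw [sub_ne_zero]; rintro rfl; exact hne hq0
    obtain ⟨a, ha⟩ := exists_linearIndependent_pair_of_one_lt_finrank h2 hb
    rw [LinearIndependent.pair_iff] at ha
    let L : ℂ × ℂ →L[ℂ] E := (ContinuousLinearMap.toSpanSingleton ℂ a).coprod
      (ContinuousLinearMap.toSpanSingleton ℂ (q₁ - q))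
    have hL : ∀ s t, L (s, t) = s • a + t • (q₁ - q) := fun s t => by simp [L]
    set γ : ℂ × ℂ → E := fun p => q + L p with hγ
    have hγd : ∀ p, HasFDerivAt γ L p := fun p => (L.hasFDerivAt (x := p)).const_add q
    have hγc : Continuous γ := continuous_const.add L.continuous
    have hγi : Function.Injective γ := by
      rintro ⟨s, t⟩ ⟨s', t'⟩ hst
      have h3 : L (s, t) = L (s', t') := add_left_cancel hst
      rw [hL, hL] at h3
      have h4 := ha (t - t') (s - s') (by
        rw [sub_smul, sub_smul, sub_add_sub_comm, sub_eq_zero, add_comm, h3, add_comm])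
      rw [sub_eq_zero, sub_eq_zero] at h4
      rw [h4.1, h4.2]
    have hΩ : IsOpen (γ ⁻¹' ball q R) := isOpen_ball.preimage hγc
    have hγ0 : γ (0, 0) = q := by simp [hγ, hL]
    have hγ1 : γ (0, 1) = q₁ := by simp [hγ, hL]
    have hmapsU : MapsTo γ (γ ⁻¹' ball q R) U := fun p hp => hRU hp
    have hjd : DifferentiableOn ℂ (fun p => J (γ p)) (γ ⁻¹' ball q R) :=
      hJd.comp (fun p _ => (hγd p).differentiableAt.differentiableWithinAt) hmapsU
    have hb' : 0 < ‖q₁ - q‖ := norm_pos_iff.2 hb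
    refine not_injOn_of_fderiv_eq_zero_on_zeros hΩ hjd (h := fun p => f (γ p))
      (hf.comp (fun p _ => (hγd p).differentiableAt.differentiableWithinAt) hmapsU)
      (fun p hp hp0 => ?_) (p₀ := (0, 0)) (by simpa [hγ0] using hR)
      (by simpa [hγ0] using (hJ' q hq).2 hq0)
      (exists_iteratedPartialSnd_ne_zero hΩ hjd (t₁ := 1) (R := R / ‖q₁ - q‖) ?_ ?_ ?_) ?_
    · have h3 := ((hf.differentiableAt (hU.mem_nhds (hmapsU hp))).hasFDerivAt).comp p (hγd p)
      rw [(hJ' _ (hmapsU hp)).1 hp0, ContinuousLinearMap.zero_comp] at h3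
      exact h3.fderiv
    · rw [mem_ball, dist_zero_right, norm_one, one_lt_div hb']
      simpa [dist_eq_norm] using hq₁
    · intro t ht
      rw [mem_ball, dist_zero_right, lt_div_iff₀ hb'] at ht
      simpa [hγ, hL, norm_smul] using ht
    · rw [hγ1, Ne, hJ' _ (hRU hq₁)]
      exact hne
    · intro p hp p' hp' hpp
      exact hγi (hinj (hmapsU hp) (hmapsU hp') hpp)

end OsgoodTheorem

section OsgoodConsequences

universe u v

/-- **Osgood's theorem**: the derivative of an injective holomorphic map between spaces of the same
dimension is everywhere invertible. By induction on the dimension, the derivative is invertible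
wherever it is not zero; then the derivative vanishes on the zero set of the Jacobian determinant,
which `not_injOn_of_fderiv_eq_zero_on_zeros` excludes. -/
theorem injective_fderiv_of_injOn (n : ℕ) : ∀ (E : Type u) (F : Type v) [NormedAddCommGroup E]
    [NormedSpace ℂ E] [NormedAddCommGroup F] [NormedSpace ℂ F] [FiniteDimensional ℂ E]
    [FiniteDimensional ℂ F], Module.finrank ℂ E = n → Module.finrank ℂ F = n →
    ∀ (f : E → F) (U : Set E), IsOpen U → DifferentiableOn ℂ f U → InjOn f U →
      ∀ x ∈ U, Function.Injective (fderiv ℂ f x) := by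
  induction n with
  | zero =>
    intro E F _ _ _ _ _ _ hE _ f U _ _ _ x _
    have : Subsingleton E := Module.finrank_zero_iff.1 hE
    exact Function.injective_of_subsingleton _
  | succ n ih =>
    intro E F _ _ _ _ _ _ hE hF f U hU hf hinj x hx
    have h : ∀ x ∈ U, fderiv ℂ f x ≠ 0 → Function.Injective (fderiv ℂ f x) := fun x hx hne =>
      injective_fderiv_of_fderiv_ne_zero
        (fun E' F' h1 h2 => ih E' F' (by exact h1) (by exact h2)) hE hF hU hf hinj hx hne
    exact h x hx (fderiv_ne_zero_of_injOn (hE.trans hF.symm) (by omega) hU hf hinj h hx)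

variable {E F : Type*} [NormedAddCommGroup E] [NormedSpace ℂ E] [NormedAddCommGroup F]
  [NormedSpace ℂ F] [FiniteDimensional ℂ E] [FiniteDimensional ℂ F] {f : E → F} {U : Set E}

theorem exists_equiv_hasStrictFDerivAt_of_injOn
    (hEF : Module.finrank ℂ E = Module.finrank ℂ F) (hU : IsOpen U)
    (hf : DifferentiableOn ℂ f U) (hinj : InjOn f U) {x : E} (hx : x ∈ U) :
    ∃ e : E ≃L[ℂ] F, HasStrictFDerivAt f (e : E →L[ℂ] F) x := by
  have hi := injective_fderiv_of_injOn _ E F rfl hEF.symm f U hU hf hinj x hx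
  refine ⟨(LinearEquiv.ofInjectiveOfFinrankEq (fderiv ℂ f x : E →ₗ[ℂ] F) hi
    hEF).toContinuousLinearEquiv, ?_⟩
  exact hf.hasStrictFDerivAt hU hx

theorem isOpen_image_of_injOn (hEF : Module.finrank ℂ E = Module.finrank ℂ F) (hU : IsOpen U)
    (hf : DifferentiableOn ℂ f U) (hinj : InjOn f U) : IsOpen (f '' U) := by
  rw [isOpen_iff_mem_nhds]
  rintro _ ⟨x, hx, rfl⟩
  obtain ⟨e, he⟩ := exists_equiv_hasStrictFDerivAt_of_injOn hEF hU hf hinj hx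
  rw [← he.map_nhds_eq_of_equiv]
  exact image_mem_map (hU.mem_nhds hx)

theorem differentiableOn_leftInverse_of_injOn (hEF : Module.finrank ℂ E = Module.finrank ℂ F)
    (hU : IsOpen U) (hf : DifferentiableOn ℂ f U) {g : F → E} (hg : LeftInvOn g f U) :
    DifferentiableOn ℂ g (f '' U) := by
  rintro _ ⟨x, hx, rfl⟩
  obtain ⟨e, he⟩ := exists_equiv_hasStrictFDerivAt_of_injOn hEF hU hf hg.injOn hx
  exact ((he.to_local_left_inverse (by
    filter_upwards [hU.mem_nhds hx] with y hy using hg hy)).hasFDerivAt).differentiableAt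
      |>.differentiableWithinAt

end OsgoodConsequences

/-! ### Limits of injections whose images exhaust the ball -/

section LimitsOfInjections

variable {E F : Type*} [NormedAddCommGroup E] [NormedSpace ℂ E] [FiniteDimensional ℂ E]
  [NormedAddCommGroup F] [NormedSpace ℂ F] [FiniteDimensional ℂ F] {ι : Type*}

theorem exists_limit_of_eventually_bound {X : Type*} (l : Ultrafilter ι) {f : ι → X → F}
    {s : Set X} {M : ℝ} (hM : ∀ x ∈ s, ∀ᶠ i in (l : Filter ι), ‖f i x‖ ≤ M) :
    ∃ g : X → F, ∀ x ∈ s, Tendsto (f · x) l (𝓝 (g x)) ∧ ‖g x‖ ≤ M := by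
  have : ProperSpace F := FiniteDimensional.proper ℂ F
  have h : ∀ x, ∃ y, x ∈ s → Tendsto (f · x) l (𝓝 y) ∧ ‖y‖ ≤ M := by
    intro x
    by_cases hx : x ∈ s
    · obtain ⟨y, hy, hy'⟩ := (isCompact_closedBall (0 : F) M).ultrafilter_le_nhds'
        (l.map (f · x)) (by
          change ∀ᶠ i in (l : Filter ι), _
          filter_upwards [hM x hx] with i hi
          simpa using hi)
      exact ⟨y, fun _ => ⟨hy', by simpa using hy⟩⟩
    · exact ⟨0, fun h => absurd h hx⟩
  choose g hg using h
  exact ⟨g, fun x hx => hg x hx⟩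

omit [FiniteDimensional ℂ E] [FiniteDimensional ℂ F] in
theorem tendsto_apply_of_tendsto {l : Filter ι} {f : ι → E → F} {x : E} {b : F} {u : ι → E}
    {R M : ℝ} (hR : 0 < R) (hd : ∀ᶠ i in l, DifferentiableOn ℂ (f i) (ball x R))
    (hM : ∀ᶠ i in l, ∀ y ∈ ball x R, ‖f i y‖ ≤ M) (hlim : Tendsto (f · x) l (𝓝 b))
    (hu : Tendsto u l (𝓝 x)) : Tendsto (fun i => f i (u i)) l (𝓝 b) := by
  have h0 : Tendsto (fun i => 2 * M / R * ‖u i - x‖) l (𝓝 0) := by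
    simpa using ((hu.sub_const x).norm.const_mul (2 * M / R))
  have h1 : Tendsto (fun i => f i (u i) - f i x) l (𝓝 0) := by
    refine squeeze_zero_norm' ?_ h0
    filter_upwards [hd, hM, hu.eventually_mem (ball_mem_nhds x hR)] with i h1 h2 h3
    exact norm_sub_le_of_bound h1 h2 h3
  simpa using h1.add hlim

omit [FiniteDimensional ℂ F] in
/-- Pointwise convergence to `0` of uniformly bounded holomorphic maps is uniform on smaller
balls. -/
theorem eventually_norm_le_of_tendsto_zero {l : Filter ι} {f : ι → E → F} {x : E} {R M : ℝ}
    (hR : 0 < R) (hd : ∀ᶠ i in l, DifferentiableOn ℂ (f i) (ball x R))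
    (hM : ∀ᶠ i in l, ∀ y ∈ ball x R, ‖f i y‖ ≤ M)
    (hlim : ∀ y ∈ ball x R, Tendsto (f · y) l (𝓝 0)) {ε : ℝ} (hε : 0 < ε) :
    ∀ᶠ i in l, ∀ y ∈ closedBall x (R / 2), ‖f i y‖ ≤ ε := by
  have : ProperSpace E := FiniteDimensional.proper ℂ E
  by_cases hbot : l = ⊥
  · simp [hbot]
  have : l.NeBot := ⟨hbot⟩
  have hM0 : 0 ≤ M := by
    obtain ⟨i, hi⟩ := hM.exists
    exact (norm_nonneg _).trans (hi x (mem_ball_self hR))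
  obtain ⟨δ, hδ, hδR, hδε⟩ : ∃ δ > 0, δ ≤ R / 2 ∧ 2 * M / (R / 2) * δ ≤ ε / 2 := by
    refine ⟨min (R / 2) (ε / 2 / (2 * M / (R / 2) + 1)), by positivity, min_le_left _ _, ?_⟩
    have h0 : 0 ≤ 2 * M / (R / 2) := by positivity
    calc 2 * M / (R / 2) * min (R / 2) (ε / 2 / (2 * M / (R / 2) + 1))
        ≤ (2 * M / (R / 2) + 1) * (ε / 2 / (2 * M / (R / 2) + 1)) := by
          gcongr
          · linarith
          · exact min_le_right _ _
      _ = ε / 2 := by field_simp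
  obtain ⟨t, ht, htf, hcov⟩ := (isCompact_closedBall x (R / 2)).finite_cover_balls hδ
  have hfin : ∀ᶠ i in l, ∀ y ∈ t, ‖f i y‖ < ε / 2 := by
    refine htf.eventually_all.2 fun y hy => ?_
    have := (hlim y (closedBall_subset_ball (by linarith) (ht hy))).norm
    rw [norm_zero] at this
    exact this.eventually_lt_const (half_pos hε)
  filter_upwards [hd, hM, hfin] with i h1 h2 h3 y hy
  obtain ⟨z, hz, hyz⟩ := mem_iUnion₂.1 (hcov hy)
  have hsub : ball z (R / 2) ⊆ ball x R := by
    intro w hw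
    have := ht hz
    rw [mem_closedBall] at this
    rw [mem_ball] at hw ⊢
    linarith [dist_triangle w z x]
  have h4 := norm_sub_le_of_bound (h1.mono hsub) (fun w hw => h2 w (hsub hw))
    (ball_subset_ball hδR hyz)
  have h5 : ‖y - z‖ ≤ δ := by rw [← dist_eq_norm]; exact (mem_ball.1 hyz).le
  have h6 : 2 * M / (R / 2) * ‖y - z‖ ≤ 2 * M / (R / 2) * δ := by gcongr
  have h7 := h3 z hz
  have h8 := norm_sub_norm_le (f i y) (f i z)
  linarith

/-- A holomorphic map that is uniformly close to the identity on a ball takes the centre of the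
ball as a value. -/
theorem exists_apply_eq_of_norm_sub_le {f : E → E} {x : E} {R : ℝ} (hR : 0 < R)
    (hf : DifferentiableOn ℂ f (ball x R)) (hle : ∀ y ∈ ball x R, ‖f y - y‖ ≤ R / 16) :
    ∃ y ∈ ball x R, f y = x := by
  have : CompleteSpace E := FiniteDimensional.complete ℂ E
  set T : E → E := fun y => y - (f y - x) with hT
  have hlip : ∀ y ∈ closedBall x (R / 2), ∀ z ∈ closedBall x (R / 2), ‖y - z‖ < R / 2 →
      ‖T y - T z‖ ≤ 1 / 4 * ‖y - z‖ := by
    intro y hy z hz hyz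
    have hsub : ball z (R / 2) ⊆ ball x R := by
      intro w hw
      rw [mem_closedBall] at hz
      rw [mem_ball] at hw ⊢
      linarith [dist_triangle w z x]
    have h := norm_sub_le_of_bound (f := fun y => f y - y) (M := R / 16)
      ((hf.mono hsub).sub differentiableOn_id) (fun w hw => hle w (hsub hw)) (y := y)
      (by rwa [mem_ball, dist_eq_norm])
    have e1 : T y - T z = -((f y - y) - (f z - z)) := by simp only [hT]; abel
    have e2 : 2 * (R / 16) / (R / 2) = 1 / 4 := by field_simp; norm_num
    rwa [e1, norm_neg, ← e2]
  have hmaps : MapsTo T (closedBall x (R / 8)) (closedBall x (R / 8)) := by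
    intro y hy
    have hy' : y ∈ ball x R := closedBall_subset_ball (by linarith) hy
    rw [mem_closedBall, dist_eq_norm]
    have : T y - x = -(f y - y) := by simp only [hT]; abel
    rw [this, norm_neg]
    linarith [hle y hy']
  have hcontr : ContractingWith (1 / 4) (hmaps.restrict T _ _) := by
    refine ⟨by rw [← NNReal.coe_lt_coe]; norm_num, LipschitzWith.of_dist_le_mul ?_⟩
    rintro ⟨y, hy⟩ ⟨z, hz⟩
    rw [Subtype.dist_eq, Subtype.dist_eq, dist_eq_norm, dist_eq_norm]
    refine (hlip y (closedBall_subset_closedBall (by linarith) hy) z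
      (closedBall_subset_closedBall (by linarith) hz) ?_).trans_eq (by simp)
    have := dist_triangle_right y z x
    rw [mem_closedBall] at hy hz
    rw [← dist_eq_norm]
    linarith
  obtain ⟨y, hy, hfix, -⟩ := hcontr.exists_fixedPoint' isClosed_closedBall.isComplete hmaps
    (x := x) (mem_closedBall_self (by positivity)) (edist_ne_top _ _)
  refine ⟨y, closedBall_subset_ball (by linarith) hy, ?_⟩
  have : y - (f y - x) = y := hfix
  rw [sub_eq_self, sub_eq_zero] at this
  exact this

/-- If injections `g i` of `D` into the unit ball converge to `G`, their images exhaust the ball,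
and `h i` inverts `g i`, then for bounded `Φ` the maps `Φ ∘ h i` converge on the ball to a
holomorphic `k` with `k ∘ G = Φ`. -/
theorem exists_limit_comp_inverse (l : Ultrafilter ι) {D : Set E} {g h : ι → E → E} {G : E → E}
    {r : ι → ℝ} (hr : Tendsto r l (𝓝 1)) (hh : ∀ i, DifferentiableOn ℂ (h i) (ball 0 (r i)))
    (hhD : ∀ i, MapsTo (h i) (ball 0 (r i)) D) (hinv : ∀ i, LeftInvOn (h i) (g i) D)
    (hG : ∀ x ∈ D, Tendsto (g · x) l (𝓝 (G x))) (hGb : MapsTo G D (ball 0 1)) {Φ : E → F}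
    (hΦ : DifferentiableOn ℂ Φ D) (hΦb : ∀ x ∈ D, ‖Φ x‖ ≤ 1) :
    ∃ k : E → F, DifferentiableOn ℂ k (ball 0 1) ∧ (∀ x ∈ D, k (G x) = Φ x) ∧
      ∀ w ∈ ball (0 : E) 1, Tendsto (fun i => Φ (h i w)) l (𝓝 (k w)) := by
  have hloc : ∀ w ∈ ball (0 : E) 1, ∃ R > 0, ball w R ⊆ ball 0 1 ∧
      ∀ᶠ i in (l : Filter ι), ball w R ⊆ ball 0 (r i) := by
    intro w hw
    rw [mem_ball, dist_zero_right] at hw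
    refine ⟨(1 - ‖w‖) / 2, by linarith, ball_subset_ball' (by rw [dist_zero_right]; linarith), ?_⟩
    filter_upwards [hr.eventually_const_lt (show (1 + ‖w‖) / 2 < 1 by linarith)] with i hi
    exact ball_subset_ball' (by rw [dist_zero_right]; linarith)
  obtain ⟨k, hk⟩ := exists_limit_of_eventually_bound l (f := fun i w => Φ (h i w))
    (s := ball 0 1) (M := 1) (by
      intro w hw
      obtain ⟨R, hR, -, hev⟩ := hloc w hw
      filter_upwards [hev] with i hi
      exact hΦb _ (hhD i (hi (mem_ball_self hR))))
  have hd : ∀ i s, s ⊆ ball 0 (r i) → DifferentiableOn ℂ (fun w => Φ (h i w)) s := fun i s hs =>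
    hΦ.comp ((hh i).mono hs) fun w hw => hhD i (hs hw)
  refine ⟨k, fun w hw => ?_, fun x hx => ?_, fun w hw => (hk w hw).1⟩
  · obtain ⟨R, hR, hsub, hev⟩ := hloc w hw
    refine (differentiableAt_of_tendsto (l : Filter ι) (M := 1) hR (hev.mono fun i hi => hd i _ hi)
      ?_ fun y hy => (hk y (hsub hy)).1).differentiableWithinAt
    filter_upwards [hev] with i hi y hy
    exact hΦb _ (hhD i (hi hy))
  · obtain ⟨R, hR, hsub, hev⟩ := hloc _ (hGb hx)
    have h1 := tendsto_apply_of_tendsto (f := fun i w => Φ (h i w)) (M := 1) hR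
      (hev.mono fun i hi => hd i _ hi)
      (by filter_upwards [hev] with i hi y hy using hΦb _ (hhD i (hi hy)))
      (hk _ (hGb hx)).1 (hG x hx)
    simp only [hinv _ hx] at h1
    exact tendsto_nhds_unique h1 tendsto_const_nhds

omit [FiniteDimensional ℂ E] [FiniteDimensional ℂ F] in
theorem eqOn_ball_of_eventuallyEq [CompleteSpace F] {f g : E → F}
    (hf : DifferentiableOn ℂ f (ball 0 1)) (hg : DifferentiableOn ℂ g (ball 0 1))
    (hfg : f =ᶠ[𝓝 0] g) : EqOn f g (ball 0 1) := by
  intro w hw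
  rw [mem_ball, dist_zero_right] at hw
  obtain ⟨ρ, hρ, hρ'⟩ : ∃ ρ : ℝ, 1 < ρ ∧ ρ * ‖w‖ < 1 := by
    rcases eq_or_ne w 0 with rfl | h
    · exact ⟨2, one_lt_two, by simp⟩
    · obtain ⟨ρ, h1, h2⟩ := exists_between ((one_lt_div (norm_pos_iff.2 h)).2 hw)
      exact ⟨ρ, h1, (lt_div_iff₀ (norm_pos_iff.2 h)).1 h2⟩
  have hmaps : MapsTo (fun t : ℂ => t • w) (ball 0 ρ) (ball 0 1) := by
    intro t ht
    rw [mem_ball, dist_zero_right] at ht ⊢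
    rw [norm_smul]
    exact (mul_le_mul_of_nonneg_right ht.le (norm_nonneg w)).trans_lt hρ'
  have hd : ∀ u : E → F, DifferentiableOn ℂ u (ball 0 1) →
      AnalyticOnNhd ℂ (fun t : ℂ => u (t • w)) (ball 0 ρ) := fun u hu =>
    (hu.comp (by fun_prop) hmaps).analyticOnNhd isOpen_ball
  have hev : (fun t : ℂ => f (t • w)) =ᶠ[𝓝 0] fun t => g (t • w) := by
    have hc : Tendsto (fun t : ℂ => t • w) (𝓝 0) (𝓝 0) := by
      have : ContinuousAt (fun t : ℂ => t • w) 0 := by fun_prop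
      simpa [ContinuousAt] using this
    exact hc.eventually hfg
  have := (hd f hf).eqOn_of_preconnected_of_eventuallyEq (hd g hg)
    (convex_ball 0 ρ).isPreconnected (mem_ball_self (by linarith)) hev
    (show (1 : ℂ) ∈ ball 0 ρ by simpa using hρ)
  simpa using this

/-- Suppose that the domain `D` has injective holomorphic maps to the unit ball that send points
converging in `D` to `0` and whose images exhaust the ball. Then `D` is biholomorphic to the
ball. -/
theorem exists_biholomorphism_of_exhausting_injections {D : Set E} (hD : IsOpen D)
    (hDc : IsConnected D) {g : ℕ → E → E} {a : ℕ → E} {a₀ : E} {r : ℕ → ℝ} (ha₀ : a₀ ∈ D)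
    (hg : ∀ j, DifferentiableOn ℂ (g j) D) (hgb : ∀ j, MapsTo (g j) D (ball 0 1))
    (hgi : ∀ j, InjOn (g j) D) (ha : Tendsto a atTop (𝓝 a₀)) (hga : ∀ j, g j (a j) = 0)
    (hr : Tendsto r atTop (𝓝 1)) (hgr : ∀ j, ball 0 (r j) ⊆ g j '' D) :
    ∃ f h : E → E, DifferentiableOn ℂ f D ∧ DifferentiableOn ℂ h (ball 0 1) ∧
      MapsTo f D (ball 0 1) ∧ MapsTo h (ball 0 1) D ∧ InvOn h f D (ball 0 1) := by
  have : ProperSpace E := FiniteDimensional.proper ℂ E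
  have : CompleteSpace E := FiniteDimensional.complete ℂ E
  set l : Ultrafilter ℕ := hyperfilter ℕ
  have hl : (l : Filter ℕ) ≤ atTop := Nat.hyperfilter_le_atTop
  replace ha := ha.mono_left hl
  replace hr := hr.mono_left hl
  have hgb' : ∀ j, ∀ x ∈ D, ‖g j x‖ ≤ 1 := fun j x hx => by
    simpa using (mem_ball.1 (hgb j hx)).le
  set h : ℕ → E → E := fun j => Function.invFunOn (g j) D
  have hinv : ∀ j, LeftInvOn (h j) (g j) D := fun j => (hgi j).leftInvOn_invFunOn
  have hhd : ∀ j, DifferentiableOn ℂ (h j) (ball 0 (r j)) := fun j =>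
    (differentiableOn_leftInverse_of_injOn rfl hD (hg j) (hinv j)).mono (hgr j)
  have hhD : ∀ j, MapsTo (h j) (ball 0 (r j)) D := fun j w hw =>
    Function.invFunOn_mem (hgr j hw)
  obtain ⟨G, hG⟩ := exists_limit_of_eventually_bound l (f := g) (s := D) (M := 1)
    fun x hx => Eventually.of_forall fun j => hgb' j x hx
  have hGd : DifferentiableOn ℂ G D := by
    intro x hx
    obtain ⟨R, hR, hRD⟩ := Metric.isOpen_iff.1 hD x hx
    exact (differentiableAt_of_tendsto (l : Filter ℕ) (M := 1) hR
      (Eventually.of_forall fun j => (hg j).mono hRD)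
      (Eventually.of_forall fun j y hy => hgb' j y (hRD hy))
      fun y hy => (hG y (hRD hy)).1).differentiableWithinAt
  have hGa : G a₀ = 0 := by
    obtain ⟨R, hR, hRD⟩ := Metric.isOpen_iff.1 hD a₀ ha₀
    have h1 := tendsto_apply_of_tendsto (M := 1) hR
      (Eventually.of_forall fun j => (hg j).mono hRD)
      (Eventually.of_forall fun j y hy => hgb' j y (hRD hy)) (hG a₀ ha₀).1 ha
    simp only [hga] at h1
    exact tendsto_nhds_unique h1 tendsto_const_nhds |>.symm ▸ rfl
  have hGb : MapsTo G D (ball 0 1) := by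
    intro x hx
    rw [mem_ball, dist_zero_right]
    refine lt_of_le_of_ne (hG x hx).2 fun hx1 => ?_
    have := Complex.norm_eqOn_of_isPreconnected_of_isMaxOn hDc.isPreconnected hD hGd hx
      (fun y hy => by simpa [hx1] using (hG y hy).2) ha₀
    simp [hGa, hx1] at this
  have hlim := fun (Φ : E → E) (hΦ : DifferentiableOn ℂ Φ D) hΦb =>
    exists_limit_comp_inverse l hr hhd hhD hinv (fun x hx => (hG x hx).1) hGb hΦ hΦb
  have hGi : InjOn G D := by
    obtain ⟨k, -, hk, -⟩ := hlim (g 0) (hg 0) (hgb' 0)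
    intro x hx y hy hxy
    refine hgi 0 hx hy ?_
    rw [← hk x hx, ← hk y hy, hxy]
  have hGo : IsOpen (G '' D) := isOpen_image_of_injOn rfl hD hGd hGi
  obtain ⟨k, hkd, hk, hklim⟩ := hlim G hGd fun x hx => (hG x hx).2
  have hkid : EqOn k id (ball 0 1) := by
    refine eqOn_ball_of_eventuallyEq hkd differentiableOn_id ?_
    filter_upwards [hGo.mem_nhds ⟨a₀, ha₀, hGa⟩]
    rintro _ ⟨x, hx, rfl⟩
    exact hk x hx
  have hsurj : ball 0 1 ⊆ G '' D := by
    intro w hw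
    have hw' : ‖w‖ < 1 := by simpa using hw
    set R := (1 - ‖w‖) / 2 with hRdef
    have hR : 0 < R := by rw [hRdef]; linarith
    have hev : ∀ᶠ j in (l : Filter ℕ), ball w R ⊆ ball 0 (r j) := by
      filter_upwards [hr.eventually_const_lt (show (1 + ‖w‖) / 2 < 1 by linarith)] with i hi
      exact ball_subset_ball' (by rw [dist_zero_right]; linarith)
    have hsub : ball w R ⊆ ball 0 1 := ball_subset_ball' (by rw [dist_zero_right]; linarith)
    have hd : ∀ᶠ j in (l : Filter ℕ), DifferentiableOn ℂ (fun y => G (h j y)) (ball w R) :=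
      hev.mono fun j hj => hGd.comp ((hhd j).mono hj) fun y hy => hhD j (hj hy)
    have hsmall := eventually_norm_le_of_tendsto_zero (l := (l : Filter ℕ))
      (f := fun j y => G (h j y) - y) (x := w) (M := 2) hR
      (hd.mono fun j hj => hj.sub differentiableOn_id)
      (by
        filter_upwards [hev] with j hj y hy
        have h1 := (hG _ (hhD j (hj hy))).2
        have h2 : ‖y‖ < 1 := by simpa using hsub hy
        linarith [norm_sub_le (G (h j y)) y])
      (fun y hy => by
        have := (hklim y (hsub hy)).sub_const y
        rwa [hkid (hsub hy), id, sub_self] at this)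
      (show 0 < R / 32 by positivity)
    obtain ⟨j, hj1, hj2, hj3⟩ := (hev.and (hd.and hsmall)).exists
    obtain ⟨y, hy, hyw⟩ := exists_apply_eq_of_norm_sub_le (f := fun y => G (h j y)) (x := w)
      (R := R / 2) (by positivity) (hj2.mono (ball_subset_ball (by linarith)))
      (fun y hy => (hj3 y (ball_subset_closedBall hy)).trans_eq (by ring))
    exact ⟨h j y, hhD j (hj1 (ball_subset_ball (by linarith) hy)), hyw⟩
  refine ⟨G, Function.invFunOn G D, hGd, ?_, hGb, fun w hw => Function.invFunOn_mem (hsurj hw),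
    hGi.leftInvOn_invFunOn, fun w hw => Function.invFunOn_eq (hsurj hw)⟩
  exact (differentiableOn_leftInverse_of_injOn rfl hD hGd hGi.leftInvOn_invFunOn).mono hsurj

end LimitsOfInjections

/-! ### Automorphisms of the unit ball -/

section BallAutomorphisms

variable {H : Type*} [NormedAddCommGroup H] [InnerProductSpace ℂ H]

/-- The involutive automorphism of the unit ball that interchanges `0` and `b`. With
`s = √(1 - ‖b‖²)` the usual formula involves `P w + s (w - P w)`, where `P` is the orthogonal
projection to `ℂ b`; this is `s w + ⟪b, w⟫ / (1 + s) b`, which needs no case distinction at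
`b = 0`. -/
noncomputable def ballInvolution (b w : H) : H :=
  (1 - inner ℂ b w)⁻¹ • ((1 - inner ℂ b w / ((1 + √(1 - ‖b‖ ^ 2) : ℝ) : ℂ)) • b -
    ((√(1 - ‖b‖ ^ 2) : ℝ) : ℂ) • w)

variable {b w : H}

theorem one_sub_inner_ne_zero (hb : ‖b‖ < 1) (hw : ‖w‖ < 1) : 1 - inner ℂ b w ≠ 0 := by
  intro h
  have h1 := norm_inner_le_norm (𝕜 := ℂ) b w
  rw [← sub_eq_zero.1 h, norm_one] at h1
  nlinarith [norm_nonneg b, norm_nonneg w]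

omit [InnerProductSpace ℂ H] in
theorem sqrt_one_sub_norm_sq_pos (hb : ‖b‖ < 1) : 0 < √(1 - ‖b‖ ^ 2) := by
  rw [Real.sqrt_pos]
  nlinarith [norm_nonneg b]

omit [InnerProductSpace ℂ H] in
theorem norm_sq_eq_one_sub_sqrt_sq (hb : ‖b‖ < 1) : ‖b‖ ^ 2 = 1 - √(1 - ‖b‖ ^ 2) ^ 2 := by
  rw [Real.sq_sqrt]
  · ring
  · nlinarith [norm_nonneg b]

theorem one_sub_norm_sq_ballInvolution (hb : ‖b‖ < 1) (hw : ‖w‖ < 1) :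
    1 - ‖ballInvolution b w‖ ^ 2 =
      (1 - ‖b‖ ^ 2) * (1 - ‖w‖ ^ 2) / ‖1 - inner ℂ b w‖ ^ 2 := by
  have hne := one_sub_inner_ne_zero hb hw
  have hs := sqrt_one_sub_norm_sq_pos hb
  have hbs := norm_sq_eq_one_sub_sqrt_sq hb
  rw [ballInvolution]
  set s := √(1 - ‖b‖ ^ 2) with hsdef
  set β : ℂ := inner ℂ b w with hβ
  have hpos : 0 < ‖1 - β‖ ^ 2 := by positivity
  have key : ‖(1 - β / ((1 + s : ℝ) : ℂ)) • b - (s : ℂ) • w‖ ^ 2 =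
      ‖1 - β‖ ^ 2 - s ^ 2 * (1 - ‖w‖ ^ 2) := by
    rw [norm_sub_sq (𝕜 := ℂ), inner_smul_left, inner_smul_right, norm_smul, norm_smul, mul_pow,
      mul_pow, hbs, ← hβ, Complex.norm_real, Real.norm_eq_abs, sq_abs, Complex.sq_norm,
      Complex.sq_norm, Complex.normSq_apply, Complex.normSq_apply]
    have hs1 : (1 + s) ≠ 0 := by positivity
    simp only [RCLike.re_to_complex, Complex.mul_re, Complex.mul_im, Complex.conj_re,
      Complex.conj_im, Complex.sub_re, Complex.sub_im, Complex.one_re, Complex.one_im,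
      Complex.ofReal_re, Complex.ofReal_im, Complex.div_ofReal_re, Complex.div_ofReal_im]
    field_simp
    ring
  rw [norm_smul, norm_inv, mul_pow, key, hbs]
  field_simp
  ring

theorem norm_ballInvolution_lt_one (hb : ‖b‖ < 1) (hw : ‖w‖ < 1) : ‖ballInvolution b w‖ < 1 := by
  have h := one_sub_norm_sq_ballInvolution hb hw
  have hne := one_sub_inner_ne_zero hb hw
  have h1 : 0 < 1 - ‖b‖ ^ 2 := by nlinarith [norm_nonneg b]
  have h2 : 0 < 1 - ‖w‖ ^ 2 := by nlinarith [norm_nonneg w]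
  have h3 : 0 < (1 - ‖b‖ ^ 2) * (1 - ‖w‖ ^ 2) / ‖1 - inner ℂ b w‖ ^ 2 := by positivity
  nlinarith [norm_nonneg (ballInvolution b w)]

theorem inner_ballInvolution (hb : ‖b‖ < 1) (hw : ‖w‖ < 1) :
    inner ℂ b (ballInvolution b w) =
      (((1 - √(1 - ‖b‖ ^ 2) ^ 2 : ℝ) : ℂ) - inner ℂ b w) / (1 - inner ℂ b w) := by
  have hne := one_sub_inner_ne_zero hb hw
  have hs := sqrt_one_sub_norm_sq_pos hb
  have hbs : (inner ℂ b b : ℂ) = ((1 - √(1 - ‖b‖ ^ 2) ^ 2 : ℝ) : ℂ) := by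
    rw [← norm_sq_eq_one_sub_sqrt_sq hb, inner_self_eq_norm_sq_to_K]
    push_cast
    rfl
  rw [ballInvolution, inner_smul_right, inner_sub_right, inner_smul_right, inner_smul_right, hbs]
  set s := √(1 - ‖b‖ ^ 2) with hsdef
  set β : ℂ := inner ℂ b w with hβ
  have hs1 : (1 + s : ℂ) ≠ 0 := by
    have : (1 + s : ℝ) ≠ 0 := by positivity
    exact_mod_cast this
  push_cast
  field_simp
  ring

theorem ballInvolution_ballInvolution (hb : ‖b‖ < 1) (hw : ‖w‖ < 1) :
    ballInvolution b (ballInvolution b w) = w := by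
  have hne := one_sub_inner_ne_zero hb hw
  have hs := sqrt_one_sub_norm_sq_pos hb
  have hi := inner_ballInvolution hb hw
  rw [ballInvolution, hi, ballInvolution]
  set s := √(1 - ‖b‖ ^ 2) with hsdef
  set β : ℂ := inner ℂ b w with hβ
  have hs0 : (s : ℂ) ≠ 0 := by exact_mod_cast hs.ne'
  have hs1 : (1 + s : ℂ) ≠ 0 := by
    have : (1 + s : ℝ) ≠ 0 := by positivity
    exact_mod_cast this
  have e1 : 1 - (((1 - s ^ 2 : ℝ) : ℂ) - β) / (1 - β) = s ^ 2 / (1 - β) := by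
    push_cast
    field_simp
    ring
  rw [e1]
  push_cast
  match_scalars
  · field_simp
    ring
  · field_simp

theorem ballInvolution_zero : ballInvolution b 0 = b := by
  simp [ballInvolution]

theorem ballInvolution_self (hb : ‖b‖ < 1) : ballInvolution b b = 0 := by
  have := ballInvolution_ballInvolution hb (w := 0) (by simp)
  rwa [ballInvolution_zero] at this

theorem differentiableOn_ballInvolution (hb : ‖b‖ < 1) :
    DifferentiableOn ℂ (ballInvolution b) (ball 0 1) := by
  intro w hw
  have hne := one_sub_inner_ne_zero hb (mem_ball_zero_iff.1 hw)
  have hi : DifferentiableAt ℂ (fun w : H => inner ℂ b w) w := (innerSL ℂ b).differentiableAt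
  have hdiv : DifferentiableAt ℂ
      (fun w : H => inner ℂ b w / ((1 + √(1 - ‖b‖ ^ 2) : ℝ) : ℂ)) w := by
    simpa only [div_eq_mul_inv] using hi.mul_const _
  refine DifferentiableAt.differentiableWithinAt ?_
  unfold ballInvolution
  exact ((hi.const_sub 1).inv hne).smul
    (((hdiv.const_sub 1).smul_const b).sub (differentiableAt_id.const_smul _))

theorem mapsTo_ballInvolution (hb : ‖b‖ < 1) :
    MapsTo (ballInvolution b) (ball 0 1) (ball 0 1) := fun w hw => by
  rw [mem_ball_zero_iff] at *
  exact norm_ballInvolution_lt_one hb hw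

theorem injOn_ballInvolution (hb : ‖b‖ < 1) : InjOn (ballInvolution b) (ball 0 1) :=
  LeftInvOn.injOn (f₁' := ballInvolution b) fun _ hw =>
    ballInvolution_ballInvolution hb (mem_ball_zero_iff.1 hw)

/-- The involution sends a ball whose complement in the unit ball is thin, compared to the
distance of `b` to the sphere, to a set that contains a large ball. -/
theorem ball_subset_image_ballInvolution (hb : ‖b‖ < 1) {s ρ : ℝ} (hs : 0 ≤ s) (hρ : ρ < 1)
    (h : 8 * (1 - s) ≤ (1 - ‖b‖) * (1 - ρ)) :
    ball 0 ρ ⊆ ballInvolution b '' (ball 0 s) := by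
  intro u hu
  have huρ : ‖u‖ < ρ := by simpa using hu
  have hu1 : ‖u‖ < 1 := huρ.trans hρ
  refine ⟨ballInvolution b u, ?_, ballInvolution_ballInvolution hb hu1⟩
  have hne := one_sub_inner_ne_zero hb hu1
  have key := one_sub_norm_sq_ballInvolution hb hu1
  have hle : ‖1 - inner ℂ b u‖ ^ 2 ≤ 4 := by
    have h1 := norm_inner_le_norm (𝕜 := ℂ) b u
    have h2 : ‖1 - inner ℂ b u‖ ≤ 2 := by
      refine (norm_sub_le _ _).trans ?_
      rw [norm_one]
      nlinarith [norm_nonneg b, norm_nonneg u]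
    nlinarith [norm_nonneg (1 - inner ℂ b u)]
  have h1 : 1 - ‖b‖ ≤ 1 - ‖b‖ ^ 2 := by nlinarith [norm_nonneg b]
  have h2 : 1 - ρ < 1 - ‖u‖ ^ 2 := by nlinarith [norm_nonneg u]
  have hpos : 0 < (1 - ‖b‖ ^ 2) * (1 - ‖u‖ ^ 2) := by
    have : 0 < 1 - ‖b‖ := by linarith
    have : 0 < 1 - ρ := by linarith
    apply mul_pos <;> linarith
  have h3 : (1 - ‖b‖ ^ 2) * (1 - ‖u‖ ^ 2) / 4 ≤ 1 - ‖ballInvolution b u‖ ^ 2 := by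
    rw [key]
    have : 0 < ‖1 - inner ℂ b u‖ ^ 2 := by positivity
    gcongr
  have h4 : (1 - ‖b‖) * (1 - ρ) < (1 - ‖b‖ ^ 2) * (1 - ‖u‖ ^ 2) := by
    have : 0 < 1 - ‖b‖ := by linarith
    have : 0 < 1 - ρ := by linarith
    nlinarith
  have h5 : 1 - s ^ 2 ≤ 2 * (1 - s) := by nlinarith [sq_nonneg (1 - s)]
  rw [mem_ball_zero_iff]
  refine lt_of_pow_lt_pow_left₀ 2 hs ?_
  linarith

/-- The Schwarz–Pick lemma for a map of the unit ball with a zero at `b`. -/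
theorem norm_apply_zero_le_of_apply_eq_zero {F : Type*} [NormedAddCommGroup F] [NormedSpace ℂ F]
    {f : H → F} (hf : DifferentiableOn ℂ f (ball 0 1)) (hm : MapsTo f (ball 0 1) (ball 0 1))
    (hb : ‖b‖ < 1) (hfb : f b = 0) : ‖f 0‖ ≤ ‖b‖ := by
  have h := Complex.norm_le_norm_of_mapsTo_ball (f := f ∘ ballInvolution b) (R := 1) (z := b)
    (hf.comp (differentiableOn_ballInvolution hb) (mapsTo_ballInvolution hb))
    ((hm.comp (mapsTo_ballInvolution hb)).mono_right ball_subset_closedBall)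
    (by simp [ballInvolution_zero, hfb]) hb
  simpa [ballInvolution_self hb] using h

end BallAutomorphisms

/-! ### The dyadic Dini condition -/

section DiniModulus

variable {E F : Type*} [NormedAddCommGroup E] [NormedAddCommGroup F] {N : E → F} {S : Set E}

theorem continuityModulus_mono {s t : ℝ} (h : s ≤ t) :
    continuityModulus N S s ≤ continuityModulus N S t := by
  unfold continuityModulus
  gcongr with x hx y hy
  exact iSup_const_mono fun hxy => hxy.trans_le h

theorem ofReal_norm_sub_le_continuityModulus {x y : E} (hx : x ∈ S) (hy : y ∈ S) {t : ℝ}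
    (h : ‖x - y‖ < t) : ENNReal.ofReal ‖N x - N y‖ ≤ continuityModulus N S t := by
  unfold continuityModulus
  exact le_iSup₂_of_le x hx (le_iSup₂_of_le y hy (le_iSup_of_le h le_rfl))

/-- The dyadic form of the Dini condition. -/
theorem DiniContinuousOn.exists_summable (h : DiniContinuousOn N S) :
    ∃ w : ℕ → ℝ, (∀ k, 0 ≤ w k) ∧ Summable w ∧ ∀ k, 1 ≤ k → ∀ x ∈ S, ∀ y ∈ S,
      ‖x - y‖ < (1 / 2) ^ k → ‖N x - N y‖ ≤ w k := by
  set W : ℕ → ℝ≥0∞ := fun k => continuityModulus N S ((1 / 2) ^ k) with hW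
  set I : ℕ → Set ℝ := fun k => Ioo ((1 / 2) ^ (k + 1)) ((1 / 2) ^ k) with hI
  have hpow : ∀ {k m : ℕ}, k ≤ m → ((1 : ℝ) / 2) ^ m ≤ (1 / 2) ^ k := fun hkm =>
    pow_le_pow_of_le_one (by norm_num) (by norm_num) hkm
  have hdisj : Pairwise (Function.onFun Disjoint I) := by
    have : ∀ k m, k < m → Disjoint (I k) (I m) := by
      intro k m hkm
      rw [Set.disjoint_left]
      intro t ht ht'
      exact absurd (ht'.2.trans_le (hpow hkm)) (not_lt.2 ht.1.le)
    intro k m hkm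
    rcases lt_or_gt_of_ne hkm with h | h
    · exact this k m h
    · exact (this m k h).symm
  have hsub : ⋃ k, I k ⊆ Ioo 0 1 := by
    refine iUnion_subset fun k t ht => ⟨lt_trans (by positivity) ht.1, ht.2.trans_le ?_⟩
    exact pow_le_one₀ (by norm_num) (by norm_num)
  have hle : ∀ k, W (k + 1) * ENNReal.ofReal (1 / 2) ≤
      ∫⁻ t in I k, continuityModulus N S t / ENNReal.ofReal t := by
    intro k
    calc W (k + 1) * ENNReal.ofReal (1 / 2)
        = ∫⁻ _ in I k, W (k + 1) / ENNReal.ofReal ((1 / 2) ^ k) := by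
          rw [setLIntegral_const, Real.volume_Ioo, ENNReal.div_eq_inv_mul,
            mul_comm _ (W (k + 1)), mul_assoc, ← ENNReal.ofReal_inv_of_pos (by positivity),
            ← ENNReal.ofReal_mul (by positivity)]
          congr 2
          rw [pow_succ]
          field_simp
          norm_num
      _ ≤ _ := by
          refine setLIntegral_mono' measurableSet_Ioo fun t ht => ?_
          exact ENNReal.div_le_div (continuityModulus_mono ht.1.le)
            (ENNReal.ofReal_le_ofReal ht.2.le)
  have hsum : ∑' k, W (k + 1) ≠ ∞ := by
    have h1 : (∑' k, W (k + 1)) * ENNReal.ofReal (1 / 2) < ∞ := by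
      rw [← ENNReal.tsum_mul_right]
      refine (ENNReal.tsum_le_tsum hle).trans_lt ?_
      rw [← lintegral_iUnion (fun k => measurableSet_Ioo) hdisj]
      exact (lintegral_mono_set hsub).trans_lt h
    intro h2
    rw [h2, ENNReal.top_mul (by simp)] at h1
    exact lt_irrefl _ h1
  refine ⟨fun k => (W k).toReal, fun k => ENNReal.toReal_nonneg,
    (summable_nat_add_iff 1).1 (ENNReal.summable_toReal hsum), fun k hk x hx y hy hxy => ?_⟩
  obtain ⟨m, rfl⟩ := Nat.exists_eq_add_of_le' hk
  exact (ENNReal.ofReal_le_iff_le_toReal (ENNReal.ne_top_of_tsum_ne_top hsum m)).1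
    (ofReal_norm_sub_le_continuityModulus hx hy hxy)

end DiniModulus

/-! ### Domains with a continuously differentiable boundary -/

section BoundaryGeometry

theorem eventually_lt_of_hasDerivAt_neg {φ : ℝ → ℝ} {φ' x : ℝ} (h : HasDerivAt φ φ' x)
    (hφ' : φ' < 0) : ∀ᶠ t in 𝓝[>] x, φ t < φ x := by
  have h1 := (hasDerivAt_iff_tendsto_slope_left_right.1 h).2.eventually_lt_const hφ'
  filter_upwards [h1, self_mem_nhdsWithin] with t ht htx
  have htx' : 0 < t - x := sub_pos.2 htx
  rw [slope_def_field, div_neg_iff] at ht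
  rcases ht with ht | ht
  · linarith [ht.2]
  · linarith [ht.1]

theorem tendsto_add_smul {E : Type*} [NormedAddCommGroup E] [NormedSpace ℝ E] (x v : E) :
    Tendsto (fun t : ℝ => x + t • v) (𝓝[>] 0) (𝓝 x) := by
  have h : Continuous fun t : ℝ => x + t • v := by fun_prop
  simpa using (h.tendsto 0).mono_left nhdsWithin_le_nhds

variable {E : Type*} [NormedAddCommGroup E] [InnerProductSpace ℝ E] [CompleteSpace E]
  {D U : Set E} {r : E → ℝ} {p x v : E}

omit [CompleteSpace E] in
theorem IsC1DefiningFunction.differentiableAt (h : IsC1DefiningFunction D U r) (hU : IsOpen U)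
    (hx : x ∈ U) : DifferentiableAt ℝ r x :=
  (h.1.differentiableOn one_ne_zero).differentiableAt (hU.mem_nhds hx)

theorem IsC1DefiningFunction.gradient_ne_zero (h : IsC1DefiningFunction D U r) (hx : x ∈ U) :
    ∇ r x ≠ 0 := by
  intro h0
  refine h.2.1 x hx ?_
  rwa [gradient, LinearIsometryEquiv.map_eq_zero_iff] at h0

theorem IsC1DefiningFunction.norm_innerUnitNormal (h : IsC1DefiningFunction D U r) (hx : x ∈ U) :
    ‖innerUnitNormal r x‖ = 1 := by
  have := norm_ne_zero_iff.2 (h.gradient_ne_zero hx)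
  rw [innerUnitNormal, norm_neg, norm_smul, norm_inv, norm_norm, inv_mul_cancel₀ this]

theorem IsC1DefiningFunction.hasDerivAt_line (h : IsC1DefiningFunction D U r) (hU : IsOpen U)
    (v : E) {t : ℝ} (hx : x + t • v ∈ U) :
    HasDerivAt (fun t : ℝ => r (x + t • v))
      (-(‖∇ r (x + t • v)‖ * inner ℝ (innerUnitNormal r (x + t • v)) v)) t := by
  have h1 := (h.differentiableAt hU hx).hasGradientAt.hasFDerivAt
  have h2 : HasDerivAt (fun t : ℝ => x + t • v) v t := by
    simpa using ((hasDerivAt_id t).smul_const v).const_add x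
  have h3 := h1.comp_hasDerivAt t h2
  have hne := norm_ne_zero_iff.2 (h.gradient_ne_zero hx)
  refine h3.congr_deriv ?_
  rw [innerUnitNormal, inner_neg_left, real_inner_smul_left, InnerProductSpace.toDual_apply_apply]
  field_simp

omit [CompleteSpace E] in
theorem IsC1DefiningFunction.mem_iff (h : IsC1DefiningFunction D U r) (hx : x ∈ U) :
    x ∈ D ↔ r x < 0 := by
  have : x ∈ D ∩ U ↔ x ∈ U ∧ r x < 0 := by rw [h.2.2]; rfl
  simpa [hx] using this

omit [CompleteSpace E] in
theorem IsC1DefiningFunction.eq_zero_of_mem_frontier (h : IsC1DefiningFunction D U r)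
    (hU : IsOpen U) (hD : IsOpen D) (hx : x ∈ frontier D) (hxU : x ∈ U) : r x = 0 := by
  rw [hD.frontier_eq] at hx
  refine le_antisymm ?_ (not_lt.1 fun h0 => hx.2 ((h.mem_iff hxU).2 h0))
  by_contra! hpos
  have hev : ∀ᶠ y in 𝓝 x, 0 < r y ∧ y ∈ U :=
    ((h.differentiableAt hU hxU).continuousAt.eventually_const_lt hpos).and (hU.mem_nhds hxU)
  obtain ⟨y, ⟨hy, hyU⟩, hyD⟩ := mem_closure_iff_nhds.1 hx.1 _ hev
  exact absurd ((h.mem_iff hyU).1 hyD) (not_lt.2 hy.le)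

theorem IsC1DefiningFunction.eventually_lt (h : IsC1DefiningFunction D U r) (hU : IsOpen U)
    (hx : x ∈ U) (hv : 0 < inner ℝ (innerUnitNormal r x) v) :
    ∀ᶠ t : ℝ in 𝓝[>] 0, r (x + t • v) < r x := by
  have h1 := h.hasDerivAt_line hU (x := x) v (t := 0) (by simpa using hx)
  simp only [zero_smul, add_zero] at h1
  have h2 := norm_pos_iff.2 (h.gradient_ne_zero hx)
  simpa using eventually_lt_of_hasDerivAt_neg h1 (by rw [neg_lt_zero]; positivity)

theorem IsC1DefiningFunction.eventually_gt (h : IsC1DefiningFunction D U r) (hU : IsOpen U)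
    (hx : x ∈ U) (hv : inner ℝ (innerUnitNormal r x) v < 0) :
    ∀ᶠ t : ℝ in 𝓝[>] 0, r x < r (x + t • v) := by
  have h1 := (h.hasDerivAt_line hU (x := x) v (t := 0) (by simpa using hx)).neg
  simp only [zero_smul, add_zero, neg_neg] at h1
  have h2 := norm_pos_iff.2 (h.gradient_ne_zero hx)
  simpa using eventually_lt_of_hasDerivAt_neg h1 (mul_neg_of_pos_of_neg h2 hv)

theorem IsC1DefiningFunction.mem_frontier_of_eq_zero (h : IsC1DefiningFunction D U r)
    (hU : IsOpen U) (hD : IsOpen D) (hxU : x ∈ U) (hx : r x = 0) : x ∈ frontier D := by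
  rw [hD.frontier_eq]
  refine ⟨?_, fun hxD => by linarith [(h.mem_iff hxU).1 hxD]⟩
  have h1 := h.eventually_lt hU hxU (v := innerUnitNormal r x)
    (by rw [real_inner_self_eq_norm_sq, h.norm_innerUnitNormal hxU]; norm_num)
  have hc : Tendsto (fun t : ℝ => x + t • innerUnitNormal r x) (𝓝[>] 0) (𝓝 x) :=
    tendsto_add_smul x _
  refine mem_closure_of_tendsto hc ?_
  filter_upwards [h1, hc.eventually (hU.mem_nhds hxU)] with t ht htU
  exact (h.mem_iff htU).2 (by linarith)

/-- A segment that starts at a boundary point and points into `D` wherever it meets the boundary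
ends in `D`. -/
theorem IsC1DefiningFunction.add_mem (h : IsC1DefiningFunction D U r) (hU : IsOpen U)
    (hD : IsOpen D) (hp : p ∈ frontier D) (hseg : ∀ t ∈ Icc (0 : ℝ) 1, p + t • v ∈ U)
    (hv : ∀ q ∈ frontier D ∩ U, ‖q - p‖ ≤ ‖v‖ → 0 < inner ℝ (innerUnitNormal r q) v) :
    p + v ∈ D := by
  have hpU : p ∈ U := by simpa using hseg 0 (by simp)
  have hneg : ∀ t ∈ Icc (0 : ℝ) 1, r (p + t • v) = 0 →
      -(‖∇ r (p + t • v)‖ * inner ℝ (innerUnitNormal r (p + t • v)) v) < 0 := by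
    intro t ht h0
    have h1 := norm_pos_iff.2 (h.gradient_ne_zero (hseg t ht))
    have h2 := hv _ ⟨h.mem_frontier_of_eq_zero hU hD (hseg t ht) h0, hseg t ht⟩ (by
      rw [add_sub_cancel_left, norm_smul, Real.norm_eq_abs, abs_of_nonneg ht.1]
      exact mul_le_of_le_one_left (norm_nonneg _) ht.2)
    rw [neg_lt_zero]
    positivity
  have hderiv := fun t (ht : t ∈ Icc (0 : ℝ) 1) => h.hasDerivAt_line hU v (hseg t ht)
  have hle : ∀ t ∈ Icc (0 : ℝ) 1, r (p + t • v) ≤ 0 := by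
    intro t ht
    refine image_le_of_deriv_right_lt_deriv_boundary (f := fun t : ℝ => r (p + t • v))
      (B := fun _ => 0) (B' := fun _ => 0)
      (fun t ht => (hderiv t ht).continuousAt.continuousWithinAt)
      (fun t ht => (hderiv t (Ico_subset_Icc_self ht)).hasDerivWithinAt) ?_
      (fun t => hasDerivAt_const t 0) (fun t ht h0 => hneg t (Ico_subset_Icc_self ht) h0) ht
    simpa using (h.eq_zero_of_mem_frontier hU hD hp hpU).le
  have h1 : (1 : ℝ) ∈ Icc (0 : ℝ) 1 := by simp
  have hpv : p + v ∈ U := by simpa using hseg 1 h1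
  rw [h.mem_iff hpv]
  refine lt_of_le_of_ne (by simpa using hle 1 h1) fun h0 => ?_
  -- otherwise the derivative at the endpoint is negative, so `r` is positive just before it
  have hd : 0 < inner ℝ (innerUnitNormal r (p + v)) v :=
    hv _ ⟨h.mem_frontier_of_eq_zero hU hD hpv h0, hpv⟩ (by simp)
  have h2 := h.eventually_gt hU hpv (v := -v) (by rw [inner_neg_right]; linarith)
  obtain ⟨t, ht, ht'⟩ := (h2.and (Ioo_mem_nhdsGT one_pos)).exists
  have h3 := hle (1 - t) ⟨by linarith [ht'.2], by linarith [ht'.1]⟩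
  rw [show p + (1 - t) • v = p + v + t • -v by module] at h3
  linarith

/-- A point of `D` lies on the inner normal at each nearest boundary point. -/
theorem IsC1DefiningFunction.sub_eq_smul_innerUnitNormal (h : IsC1DefiningFunction D U r)
    (hU : IsOpen U) (hD : IsOpen D) (hp : p ∈ frontier D) (hpU : p ∈ U) {z : E}
    (hball : ball z ‖z - p‖ ⊆ D) : z - p = ‖z - p‖ • innerUnitNormal r p := by
  set d := ‖z - p‖ with hd
  set ν := innerUnitNormal r p with hν
  have hν1 : ‖ν‖ = 1 := h.norm_innerUnitNormal hpU
  have key : ∀ v, 0 < inner ℝ v (z - p) → 0 ≤ inner ℝ ν v := by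
    intro v hv
    by_contra! hneg
    have h1 := h.eventually_gt hU hpU hneg
    have hlim : Tendsto (fun t : ℝ => t * ‖v‖ ^ 2) (𝓝[>] 0) (𝓝 0) := by
      simpa using tendsto_add_smul (0 : ℝ) (‖v‖ ^ 2)
    have hc : Tendsto (fun t : ℝ => p + t • v) (𝓝[>] 0) (𝓝 p) :=
      tendsto_add_smul p v
    obtain ⟨t, ⟨⟨ht1, ht2⟩, ht3⟩, ht4⟩ := (((h1.and (hlim.eventually_lt_const hv)).and
      (hc.eventually (hU.mem_nhds hpU))).and self_mem_nhdsWithin).exists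
    have ht0 : 0 < t := ht4
    have hmem : p + t • v ∈ ball z d := by
      rw [mem_ball, dist_eq_norm]
      refine lt_of_pow_lt_pow_left₀ 2 (norm_nonneg _) ?_
      rw [show p + t • v - z = t • v - (z - p) by abel, norm_sub_sq_real, norm_smul, mul_pow,
        Real.norm_eq_abs, sq_abs, real_inner_smul_left, ← hd]
      nlinarith
    have h3 := (h.mem_iff ht3).1 (hball hmem)
    rw [h.eq_zero_of_mem_frontier hU hD hp hpU] at ht1
    linarith
  rw [← sub_eq_zero, ← norm_eq_zero, ← sq_eq_zero_iff]
  refine le_antisymm ?_ (sq_nonneg _)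
  have hexp : ‖z - p - d • ν‖ ^ 2 = 2 * d * (d - inner ℝ ν (z - p)) := by
    rw [norm_sub_sq_real, norm_smul, hν1, real_inner_smul_right, real_inner_comm, Real.norm_eq_abs,
      mul_one, sq_abs, ← hd]
    ring
  rw [hexp]
  have hd0 : 0 ≤ d := norm_nonneg _
  by_contra! hpos
  have hlt : inner ℝ ν (z - p) < d := by nlinarith
  have hdpos : 0 < d := by
    rcases hd0.eq_or_lt with h0 | h0
    · rw [← h0] at hpos; simp at hpos
    · exact h0
  have h1 := key (z - p - d • ν) (by
    rw [inner_sub_left, real_inner_smul_left, real_inner_self_eq_norm_sq, ← hd]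
    nlinarith)
  rw [inner_sub_right, real_inner_smul_right, real_inner_self_eq_norm_sq, hν1] at h1
  linarith

end BoundaryGeometry

theorem ball_subset_of_le_infDist_frontier {E : Type*} [NormedAddCommGroup E] [NormedSpace ℝ E]
    {D : Set E} {z : E} {d : ℝ} (hD : IsOpen D) (hz : z ∈ D) (hd : d ≤ infDist z (frontier D)) :
    ball z d ⊆ D := by
  rcases le_or_gt d 0 with hd0 | hd0
  · simp [ball_eq_empty.2 hd0]
  refine (convex_ball z d).isPreconnected.subset_left_of_subset_union hD
    isClosed_closure.isOpen_compl (disjoint_compl_right.mono_left subset_closure) ?_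
    ⟨z, mem_ball_self hd0, hz⟩
  intro y hy
  by_contra hyD
  rw [mem_union, not_or, mem_compl_iff, not_not] at hyD
  have := infDist_le_dist_of_mem (x := z) (hD.frontier_eq ▸ ⟨hyD.2, hyD.1⟩ : y ∈ frontier D)
  rw [mem_ball, dist_comm] at hy
  linarith

/-! ### A holomorphic model of a Dini-smooth boundary -/

section DiniMap

theorem norm_one_add_ge {a : ℝ} (ha : 0 ≤ a) {ζ : ℂ} (hζ : 0 ≤ ζ.re) : 1 ≤ ‖1 + a * ζ‖ := by
  refine le_trans ?_ (Complex.re_le_norm _)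
  simp only [Complex.add_re, Complex.one_re, Complex.re_ofReal_mul]
  nlinarith

theorem re_div_one_add {a : ℝ} {ζ : ℂ} :
    (ζ / (1 + a * ζ)).re = (ζ.re + a * ‖ζ‖ ^ 2) / ‖1 + a * ζ‖ ^ 2 := by
  rw [Complex.div_re, ← add_div, Complex.sq_norm, Complex.sq_norm, Complex.normSq_apply ζ]
  congr 1
  simp only [Complex.add_re, Complex.one_re, Complex.re_ofReal_mul, Complex.add_im,
    Complex.one_im, Complex.im_ofReal_mul]
  ring

variable {u : ℕ → ℝ}

/-- A holomorphic map of the right half-plane. If `∑ u k ≤ 1 / 64`, its absolute value is at most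
`2 ‖ζ‖`, while at the scale `2⁻ᵏ` its real part is at least a multiple of `u k 2⁻ᵏ`, also near the
imaginary axis. So near `0` the image stays inside a curve that is tangent to the axis to the order
prescribed by `u`. -/
noncomputable def diniMap (u : ℕ → ℝ) (ζ : ℂ) : ℂ :=
  ζ * (1 + 64 * ∑' k, (u k : ℂ) / (1 + ((2 ^ k : ℝ) : ℂ) * ζ))

theorem norm_div_one_add_le (hu : ∀ k, 0 ≤ u k) {ζ : ℂ} (hζ : 0 ≤ ζ.re) (k : ℕ) :
    ‖(u k : ℂ) / (1 + ((2 ^ k : ℝ) : ℂ) * ζ)‖ ≤ u k := by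
  rw [norm_div, Complex.norm_real, Real.norm_eq_abs, abs_of_nonneg (hu k)]
  exact div_le_self (hu k) (norm_one_add_ge (by positivity) hζ)

theorem norm_tsum_div_one_add_le (hu : ∀ k, 0 ≤ u k) (hs : Summable u)
    (hs1 : ∑' k, u k ≤ 1 / 64) {ζ : ℂ} (hζ : 0 ≤ ζ.re) :
    ‖64 * ∑' k, (u k : ℂ) / (1 + ((2 ^ k : ℝ) : ℂ) * ζ)‖ ≤ 1 := by
  have h := tsum_of_norm_bounded hs.hasSum (norm_div_one_add_le hu hζ)
  rw [norm_mul, show ‖(64 : ℂ)‖ = 64 by norm_num]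
  linarith

theorem norm_diniMap_le (hu : ∀ k, 0 ≤ u k) (hs : Summable u) (hs1 : ∑' k, u k ≤ 1 / 64) {ζ : ℂ}
    (hζ : 0 ≤ ζ.re) : ‖diniMap u ζ‖ ≤ 2 * ‖ζ‖ := by
  rw [diniMap, norm_mul, mul_comm]
  gcongr
  refine (norm_add_le _ _).trans ?_
  linarith [norm_tsum_div_one_add_le hu hs hs1 hζ, norm_one (α := ℂ)]

theorem differentiableOn_diniMap (hu : ∀ k, 0 ≤ u k) (hs : Summable u) :
    DifferentiableOn ℂ (diniMap u) {ζ | 0 < ζ.re} := by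
  have ho : IsOpen {ζ : ℂ | 0 < ζ.re} := isOpen_lt continuous_const Complex.continuous_re
  have h1 := Complex.differentiableOn_tsum_of_summable_norm hs
    (F := fun k ζ => (u k : ℂ) / (1 + ((2 ^ k : ℝ) : ℂ) * ζ)) (fun k ζ hζ => ?_) ho
    (fun k ζ hζ => norm_div_one_add_le hu (le_of_lt hζ) k)
  · exact differentiableOn_id.mul ((h1.const_mul 64).const_add 1)
  · have hne : 1 + ((2 ^ k : ℝ) : ℂ) * ζ ≠ 0 := norm_pos_iff.1
      (one_pos.trans_le (norm_one_add_ge (a := 2 ^ k) (by positivity) (le_of_lt hζ)))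
    refine DifferentiableAt.differentiableWithinAt ?_
    exact (differentiableAt_const _).div (by fun_prop) hne

/-- All terms of the series contribute a positive real part. The term of the scale of `ζ` alone
contributes at least `4 u m ‖ζ‖`, which is a bound for `2 u m |Im|` because the absolute value of
the map is at most `2 ‖ζ‖`; the summand `ζ` makes the inequality strict. -/
theorem two_mul_im_diniMap_lt (hu : ∀ k, 0 ≤ u k) (hs : Summable u) (hs1 : ∑' k, u k ≤ 1 / 64)
    {ζ : ℂ} (hζ : 0 < ζ.re) {m : ℕ} (hm : (1 / 2) ^ (m + 1) ≤ 4 * ‖ζ‖)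
    (hm' : 4 * ‖ζ‖ ≤ (1 / 2) ^ m) :
    0 < (diniMap u ζ).re ∧ 2 * |(diniMap u ζ).im| * u m < (diniMap u ζ).re := by
  have hζ0 : 0 < ‖ζ‖ := hζ.trans_le (Complex.re_le_norm ζ)
  have hsum : Summable fun k => (u k : ℂ) / (1 + ((2 ^ k : ℝ) : ℂ) * ζ) :=
    Summable.of_norm_bounded hs (norm_div_one_add_le hu hζ.le)
  have hre : HasSum (fun k => u k * (ζ / (1 + ((2 ^ k : ℝ) : ℂ) * ζ)).re)
      (ζ * ∑' k, (u k : ℂ) / (1 + ((2 ^ k : ℝ) : ℂ) * ζ)).re := by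
    have h := Complex.hasSum_re (hsum.hasSum.mul_left ζ)
    convert h using 2 with k
    rw [← mul_div_assoc, mul_comm ζ, mul_div_assoc, Complex.re_ofReal_mul]
  have hnn : ∀ k, 0 ≤ u k * (ζ / (1 + ((2 ^ k : ℝ) : ℂ) * ζ)).re := by
    intro k
    rw [re_div_one_add]
    have := hu k
    positivity
  have hle := le_hasSum hre m fun k _ => hnn k
  rw [re_div_one_add] at hle
  have hn : ‖1 + ((2 ^ m : ℝ) : ℂ) * ζ‖ ^ 2 ≤ 2 := by
    have h1 : ‖1 + ((2 ^ m : ℝ) : ℂ) * ζ‖ ≤ 1 + 2 ^ m * ‖ζ‖ := by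
      refine (norm_add_le _ _).trans ?_
      rw [norm_one, norm_mul, Complex.norm_real, Real.norm_eq_abs, abs_of_pos (by positivity)]
    have h2 : 2 ^ m * ‖ζ‖ ≤ 1 / 4 := by
      rw [one_div, inv_pow, ← one_div, le_div_iff₀ (by positivity)] at hm'
      linarith
    have h3 : ‖1 + ((2 ^ m : ℝ) : ℂ) * ζ‖ ≤ 5 / 4 := by linarith
    nlinarith [norm_nonneg (1 + ((2 ^ m : ℝ) : ℂ) * ζ)]
  have hlow : u m * (‖ζ‖ / 16) ≤
      u m * ((ζ.re + 2 ^ m * ‖ζ‖ ^ 2) / ‖1 + ((2 ^ m : ℝ) : ℂ) * ζ‖ ^ 2) := by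
    refine mul_le_mul_of_nonneg_left ?_ (hu m)
    have hpos : 0 < ‖1 + ((2 ^ m : ℝ) : ℂ) * ζ‖ ^ 2 :=
      pow_pos (one_pos.trans_le (norm_one_add_ge (a := 2 ^ m) (by positivity) hζ.le)) 2
    rw [le_div_iff₀ hpos]
    have h1 : 1 / 8 ≤ 2 ^ m * ‖ζ‖ := by
      rw [one_div, inv_pow, ← one_div, div_le_iff₀ (by positivity), pow_succ] at hm
      linarith
    calc ‖ζ‖ / 16 * ‖1 + ((2 ^ m : ℝ) : ℂ) * ζ‖ ^ 2 ≤ ‖ζ‖ / 16 * 2 := by gcongr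
      _ = 1 / 8 * ‖ζ‖ := by ring
      _ ≤ 2 ^ m * ‖ζ‖ * ‖ζ‖ := by gcongr
      _ ≤ ζ.re + 2 ^ m * ‖ζ‖ ^ 2 := by nlinarith
  have hF : (diniMap u ζ).re =
      ζ.re + 64 * (ζ * ∑' k, (u k : ℂ) / (1 + ((2 ^ k : ℝ) : ℂ) * ζ)).re := by
    rw [diniMap, mul_add, mul_one, Complex.add_re, mul_left_comm]
    congr 1
    exact Complex.re_ofReal_mul 64 _
  have hFre : ζ.re + 4 * (u m * ‖ζ‖) ≤ (diniMap u ζ).re := by rw [hF]; linarith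
  have hFim : |(diniMap u ζ).im| ≤ 2 * ‖ζ‖ :=
    (Complex.abs_im_le_norm _).trans (norm_diniMap_le hu hs hs1 hζ.le)
  have hnn' : 0 ≤ u m * ‖ζ‖ := mul_nonneg (hu m) hζ0.le
  refine ⟨by linarith, ?_⟩
  have : 2 * |(diniMap u ζ).im| * u m ≤ 2 * (2 * ‖ζ‖) * u m := by
    have := hu m
    gcongr
  linarith

theorem exists_diniMap_eq (hu : ∀ k, 0 ≤ u k) (hs : Summable u) (hs1 : ∑' k, u k ≤ 1 / 64)
    {d : ℝ} (hd : 0 < d) : ∃ x : ℝ, d / 2 ≤ x ∧ x ≤ d ∧ diniMap u x = d := by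
  set S : ℝ → ℝ := fun x => ∑' k, u k / (1 + 2 ^ k * x) with hS
  have hval : ∀ x : ℝ, diniMap u x = ((x * (1 + 64 * S x) : ℝ) : ℂ) := by
    intro x
    rw [diniMap]
    push_cast [hS]
    rfl
  have hS0 : ∀ x, 0 < x → 0 ≤ S x := fun x hx => tsum_nonneg fun k => by
    have := hu k
    positivity
  have hS1 : ∀ x, 0 < x → 64 * S x ≤ 1 := by
    intro x hx
    have h := norm_tsum_div_one_add_le hu hs hs1 (ζ := (x : ℂ)) (by simpa using hx.le)
    have e : (64 * ∑' k, (u k : ℂ) / (1 + ((2 ^ k : ℝ) : ℂ) * x)) = ((64 * S x : ℝ) : ℂ) := by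
      push_cast [hS]
      rfl
    rw [e, Complex.norm_real] at h
    exact (le_abs_self _).trans h
  have hcont : ContinuousOn (fun x : ℝ => x * (1 + 64 * S x)) (Icc (d / 2) d) := by
    have h1 : ContinuousOn (fun x : ℝ => (diniMap u x).re) (Icc (d / 2) d) := by
      refine Complex.continuous_re.comp_continuousOn
        ((differentiableOn_diniMap hu hs).continuousOn.comp
          Complex.continuous_ofReal.continuousOn fun x hx => ?_)
      change 0 < ((x : ℂ)).re
      rw [Complex.ofReal_re]
      linarith [hx.1]
    refine h1.congr fun x _ => ?_
    change _ = (diniMap u x).re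
    rw [hval, Complex.ofReal_re]
  obtain ⟨x, hx, hxd⟩ := intermediate_value_Icc (by linarith) hcont (show d ∈ Icc _ _ from
    ⟨by nlinarith [hS1 (d / 2) (by linarith)], by nlinarith [hS0 d hd]⟩)
  exact ⟨x, hx.1, hx.2, by rw [hval]; exact congrArg _ hxd⟩

end DiniMap

/-! ### Holomorphic discs at a Dini-smooth boundary point -/

section DiscsAtTheBoundary

variable {n : ℕ} {D U : Set (EuclideanSpace ℂ (Fin n))} {r : EuclideanSpace ℂ (Fin n) → ℝ}
  {p p₀ : EuclideanSpace ℂ (Fin n)}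

theorem inner_real_I_smul_self (x : EuclideanSpace ℂ (Fin n)) :
    inner ℝ x (Complex.I • x) = 0 := by
  rw [PiLp.inner_apply]
  refine Finset.sum_eq_zero fun i _ => ?_
  rw [PiLp.smul_apply, Complex.inner, smul_eq_mul]
  simp
  ring

theorem inner_real_complex_smul (x y : EuclideanSpace ℂ (Fin n)) (ζ : ℂ) :
    inner ℝ x (ζ • y) = ζ.re * inner ℝ x y + ζ.im * inner ℝ x (Complex.I • y) := by
  have : ζ • y = ζ.re • y + ζ.im • (Complex.I • y) := by
    conv_lhs => rw [← Complex.re_add_im ζ]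
    rw [add_smul, mul_smul, Complex.coe_smul, Complex.coe_smul]
  rw [this, inner_add_right, real_inner_smul_right, real_inner_smul_right]

/-- The complex line spanned by the normal at a boundary point meets `D` in a set that is described
by the modulus of continuity of the normal. -/
theorem IsC1DefiningFunction.add_smul_innerUnitNormal_mem (h : IsC1DefiningFunction D U r)
    (hU : IsOpen U) (hD : IsOpen D) (hp : p ∈ frontier D) {ζ : ℂ} {w : ℝ}
    (hsub : closedBall p ‖ζ‖ ⊆ U) (hw : ∀ q ∈ frontier D ∩ U, ‖q - p‖ ≤ ‖ζ‖ →
      ‖innerUnitNormal r q - innerUnitNormal r p‖ ≤ w) (hw1 : w ≤ 1) (hζ : 0 < ζ.re)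
    (hζw : 2 * |ζ.im| * w < ζ.re) : p + ζ • innerUnitNormal r p ∈ D := by
  have hpU : p ∈ U := hsub (mem_closedBall_self (norm_nonneg _))
  have hp1 := h.norm_innerUnitNormal hpU
  have hnorm : ‖ζ • innerUnitNormal r p‖ = ‖ζ‖ := by rw [norm_smul, hp1, mul_one]
  refine h.add_mem hU hD hp (fun t ht => hsub ?_) fun q hq hqp => ?_
  · rw [mem_closedBall, dist_eq_norm, add_sub_cancel_left, norm_smul, hnorm, Real.norm_eq_abs,
      abs_of_nonneg ht.1]
    exact mul_le_of_le_one_left (norm_nonneg _) ht.2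
  · rw [hnorm] at hqp
    have hqw := hw q hq hqp
    have hw0 : 0 ≤ w := (norm_nonneg _).trans hqw
    have hq1 := h.norm_innerUnitNormal hq.2
    have h1 : 1 / 2 ≤ inner ℝ (innerUnitNormal r q) (innerUnitNormal r p) := by
      have := norm_sub_sq_real (innerUnitNormal r q) (innerUnitNormal r p)
      rw [hp1, hq1] at this
      nlinarith [norm_nonneg (innerUnitNormal r q - innerUnitNormal r p)]
    have h2 : |inner ℝ (innerUnitNormal r q) (Complex.I • innerUnitNormal r p)| ≤ w := by
      have e : inner ℝ (innerUnitNormal r q) (Complex.I • innerUnitNormal r p) =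
          inner ℝ (innerUnitNormal r q - innerUnitNormal r p)
            (Complex.I • innerUnitNormal r p) := by
        rw [inner_sub_left, inner_real_I_smul_self, sub_zero]
      rw [e]
      refine (abs_real_inner_le_norm _ _).trans ?_
      rwa [norm_smul, Complex.norm_I, hp1, one_mul, mul_one]
    rw [inner_real_complex_smul]
    have h3 : |ζ.im * inner ℝ (innerUnitNormal r q) (Complex.I • innerUnitNormal r p)| ≤
        |ζ.im| * w := by
      rw [abs_mul]
      gcongr
    have h4 := neg_abs_le
      (ζ.im * inner ℝ (innerUnitNormal r q) (Complex.I • innerUnitNormal r p))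
    nlinarith

/-- Holomorphic discs in `D`, with centres that depend only on the boundary point, that reach into
the boundary along the inner normal. -/
theorem IsC1DefiningFunction.exists_discs (h : IsC1DefiningFunction D U r)
    (hU : IsOpen U) (hD : IsOpen D) (hp₀U : p₀ ∈ U) {w : ℕ → ℝ} (hw0 : ∀ k, 0 ≤ w k)
    (hws : Summable w) (hw : ∀ k, 1 ≤ k → ∀ x ∈ frontier D ∩ U, ∀ y ∈ frontier D ∩ U,
      ‖x - y‖ < (1 / 2) ^ k → ‖innerUnitNormal r x - innerUnitNormal r y‖ ≤ w k) :
    ∃ R > 0, ∃ ρ > 0, ∃ F : ℂ → ℂ, ball p₀ R ⊆ U ∧ DifferentiableOn ℂ F {ζ | 0 < ζ.re} ∧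
      (∀ p ∈ frontier D ∩ ball p₀ R, ∀ ζ : ℂ, 0 < ζ.re → ‖ζ‖ < ρ →
        p + F ζ • innerUnitNormal r p ∈ D) ∧
      ∀ d : ℝ, 0 < d → ∃ x : ℝ, d / 2 ≤ x ∧ x ≤ d ∧ F x = d := by
  obtain ⟨R, hR, hRU⟩ := Metric.isOpen_iff.1 hU p₀ hp₀U
  obtain ⟨k₀, ⟨hk₀, hk₀R⟩, hk₀w⟩ : ∃ k₀, (1 ≤ k₀ ∧ (1 / 2 : ℝ) ^ k₀ < R / 2) ∧
      ∑' k, w (k + k₀) < 1 / 64 := by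
    have h1 := (tendsto_pow_atTop_nhds_zero_of_lt_one (r := (1 / 2 : ℝ)) (by norm_num)
      (by norm_num)).eventually_lt_const (show 0 < R / 2 by positivity)
    have h2 := (tendsto_sum_nat_add w).eventually_lt_const (show (0 : ℝ) < 1 / 64 by norm_num)
    exact (((eventually_ge_atTop 1).and h1).and h2).exists
  -- truncation makes the sum small and does not affect scales below `2 ^ (-k₀)`
  set u : ℕ → ℝ := fun k => if k < k₀ then 0 else w k with hu
  have hu0 : ∀ k, 0 ≤ u k := fun k => by
    simp only [hu]
    split_ifs
    · exact le_rfl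
    · exact hw0 k
  have hus : Summable u := hws.of_nonneg_of_le hu0 fun k => by
    simp only [hu]
    split_ifs
    · exact hw0 k
    · exact le_rfl
  have hus1 : ∑' k, u k ≤ 1 / 64 := by
    rw [← hus.sum_add_tsum_nat_add k₀, Finset.sum_eq_zero, zero_add]
    · have : ∀ k, u (k + k₀) = w (k + k₀) := fun k => by simp [hu]
      simp_rw [this]
      exact hk₀w.le
    · intro k hk
      simp [hu, Finset.mem_range.1 hk]
  refine ⟨R / 2, half_pos hR, (1 / 2) ^ k₀ / 4, by positivity, diniMap u,
    (ball_subset_ball (by linarith)).trans hRU, differentiableOn_diniMap hu0 hus, ?_,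
    fun d hd => exists_diniMap_eq hu0 hus hus1 hd⟩
  rintro p ⟨hp, hpR⟩ ζ hζ hζρ
  have hζ0 : 0 < ‖ζ‖ := hζ.trans_le (Complex.re_le_norm ζ)
  have hk₀1 : (1 / 2 : ℝ) ^ k₀ ≤ 1 := pow_le_one₀ (by norm_num) (by norm_num)
  obtain ⟨m, hm, hm'⟩ := exists_nat_pow_near_of_lt_one (x := 4 * ‖ζ‖) (y := (1 / 2 : ℝ))
    (by positivity) (by linarith) (by norm_num) (by norm_num)
  have hmk : k₀ ≤ m := by
    by_contra! hlt
    have : (1 / 2 : ℝ) ^ k₀ ≤ (1 / 2) ^ (m + 1) :=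
      pow_le_pow_of_le_one (by norm_num) (by norm_num) hlt
    linarith
  have hmk' : (1 / 2 : ℝ) ^ m ≤ (1 / 2) ^ k₀ :=
    pow_le_pow_of_le_one (by norm_num) (by norm_num) hmk
  have hum : u m = w m := by simp [hu, hmk]
  obtain ⟨h1, h2⟩ := two_mul_im_diniMap_lt hu0 hus hus1 hζ hm.le hm'
  have hF : ‖diniMap u ζ‖ < (1 / 2) ^ m := by
    linarith [norm_diniMap_le hu0 hus hus1 hζ.le]
  refine h.add_smul_innerUnitNormal_mem hU hD hp ?_ (fun q hq hqp => ?_) ?_ h1 (hum ▸ h2)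
  · refine Subset.trans (fun y hy => ?_) hRU
    rw [mem_ball] at hpR ⊢
    rw [mem_closedBall] at hy
    linarith [dist_triangle y p p₀]
  · exact hw m (hk₀.trans hmk) q hq p ⟨hp, hRU (ball_subset_ball (by linarith) hpR)⟩
      (hqp.trans_lt hF)
  · rw [← hum]
    exact ((hus.le_tsum m fun k _ => hu0 k).trans hus1).trans (by norm_num)

/-- Near a Dini-smooth boundary point, the hyperbolic distance from `z` to points near a fixed point
`a₀` of `D` is bounded in terms of the distance `δ(z)` of `z` to the boundary: a holomorphic map to
the unit ball with a zero at `z` has norm at most `1 - c δ(z)` at such a point. -/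
theorem IsDiniSmoothBoundaryPoint.exists_mul_boundaryDist_le (hD : IsOpen D)
    (hp₀ : IsDiniSmoothBoundaryPoint D p₀) :
    ∃ a₀ ∈ D, ∃ c > 0, ∀ ε > 0, ∀ᶠ z in 𝓝[D] p₀, ∃ a ∈ D, dist a a₀ < ε ∧
      ∀ f : EuclideanSpace ℂ (Fin n) → EuclideanSpace ℂ (Fin n), DifferentiableOn ℂ f D →
        MapsTo f D (ball 0 1) → f z = 0 → c * boundaryDist D z ≤ 1 - ‖f a‖ := by
  obtain ⟨hpf, U, r, hU, hpU, hdef, hdini⟩ := hp₀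
  obtain ⟨w, hw0, hws, hw⟩ := hdini.exists_summable
  obtain ⟨R, hR, ρ, hρ, F, hRU, hFd, hFD, hFx⟩ := hdef.exists_discs hU hD hpU hw0 hws hw
  set ν := innerUnitNormal r with hν
  set F₀ := F ((ρ / 2 : ℝ) : ℂ) with hF₀
  have hρ2 : ∀ p ∈ frontier D ∩ ball p₀ R, p + F₀ • ν p ∈ D := fun p hp =>
    hFD p hp _ (by rw [Complex.ofReal_re]; positivity)
      (by rw [Complex.norm_real, Real.norm_eq_abs, abs_of_pos (by positivity)]; linarith)
  refine ⟨p₀ + F₀ • ν p₀, hρ2 p₀ ⟨hpf, mem_ball_self hR⟩, 1 / ρ, by positivity, fun ε hε => ?_⟩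
  obtain ⟨k, hk, hkw⟩ : ∃ k, 1 ≤ k ∧ ‖F₀‖ * w k < ε / 2 := by
    have h1 : Tendsto (fun k => ‖F₀‖ * w k) atTop (𝓝 0) := by
      simpa using hws.tendsto_atTop_zero.const_mul ‖F₀‖
    exact ((eventually_ge_atTop 1).and (h1.eventually_lt_const (half_pos hε))).exists
  obtain ⟨η, hη, hηε, hηk, hηR, hηρ⟩ :
      ∃ η > 0, 2 * η ≤ ε / 2 ∧ 2 * η ≤ (1 / 2) ^ k ∧ 2 * η ≤ R ∧ η ≤ ρ / 2 := by
    refine ⟨min (min (ε / 4) ((1 / 2) ^ k / 2)) (min (R / 2) (ρ / 2)), by positivity, ?_, ?_, ?_,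
      (min_le_right _ _).trans (min_le_right _ _)⟩
    · linarith [(min_le_left _ _ : min (min (ε / 4) ((1 / 2 : ℝ) ^ k / 2)) (min (R / 2) (ρ / 2)) ≤
        _).trans (min_le_left _ _)]
    · linarith [(min_le_left _ _ : min (min (ε / 4) ((1 / 2 : ℝ) ^ k / 2)) (min (R / 2) (ρ / 2)) ≤
        _).trans (min_le_right _ _)]
    · linarith [(min_le_right _ _ : min (min (ε / 4) ((1 / 2 : ℝ) ^ k / 2)) (min (R / 2) (ρ / 2)) ≤
        _).trans (min_le_left _ _)]
  filter_upwards [self_mem_nhdsWithin, mem_nhdsWithin_of_mem_nhds (ball_mem_nhds p₀ hη)]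
    with z hzD hz
  rw [mem_ball] at hz
  obtain ⟨p, hp, hpz⟩ := isClosed_frontier.exists_infDist_eq_dist ⟨p₀, hpf⟩ z
  have hzp : dist z p ≤ dist z p₀ := hpz ▸ infDist_le_dist_of_mem hpf
  have hpp₀ : dist p p₀ < 2 * η := by
    linarith [dist_triangle_left p p₀ z]
  have hpR : p ∈ frontier D ∩ ball p₀ R := ⟨hp, by rw [mem_ball]; linarith⟩
  have hpU' : p ∈ U := hRU hpR.2
  have hdist : boundaryDist D z = ‖z - p‖ := by rw [boundaryDist, hpz, dist_eq_norm]
  have hnormal : z - p = ‖z - p‖ • ν p :=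
    hdef.sub_eq_smul_innerUnitNormal hU hD hp hpU'
      (ball_subset_of_le_infDist_frontier hD hzD hdist.ge)
  have hd : 0 < ‖z - p‖ := by
    rw [norm_pos_iff, sub_ne_zero]
    rintro rfl
    exact (hD.frontier_eq ▸ hp).2 hzD
  have hdρ : ‖z - p‖ < ρ / 2 := by rw [← dist_eq_norm]; linarith
  obtain ⟨x, hx1, hx2, hFxd⟩ := hFx _ hd
  refine ⟨p + F₀ • ν p, hρ2 p hpR, ?_, fun f hf hfm hfz => ?_⟩
  · have h1 : ‖ν p - ν p₀‖ ≤ w k :=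
      hw k hk p ⟨hp, hpU'⟩ p₀ ⟨hpf, hpU⟩ (by rw [← dist_eq_norm]; linarith)
    rw [dist_eq_norm, show p + F₀ • ν p - (p₀ + F₀ • ν p₀) = p - p₀ + F₀ • (ν p - ν p₀) by module]
    refine (norm_add_le _ _).trans_lt ?_
    rw [norm_smul, ← dist_eq_norm]
    have : ‖F₀‖ * ‖ν p - ν p₀‖ ≤ ‖F₀‖ * w k := by gcongr
    linarith
  · -- the disc has centre `p + F₀ ν(p)` and passes through `z` at the parameter `1 - 2 x / ρ`
    set ψ : ℂ → EuclideanSpace ℂ (Fin n) :=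
      fun s => p + F (((ρ / 2 : ℝ) : ℂ) * (1 - s)) • ν p with hψ
    have hre : ∀ s ∈ ball (0 : ℂ) 1, 0 < (((ρ / 2 : ℝ) : ℂ) * (1 - s)).re := by
      intro s hs
      rw [Complex.re_ofReal_mul, Complex.sub_re, Complex.one_re]
      have := (Complex.re_le_norm s).trans_lt (mem_ball_zero_iff.1 hs)
      have h2 : 0 < 1 - s.re := by linarith
      positivity
    have hψm : MapsTo ψ (ball 0 1) D := by
      intro s hs
      refine hFD p hpR _ (hre s hs) ?_
      rw [norm_mul, Complex.norm_real, Real.norm_eq_abs, abs_of_pos (by positivity)]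
      have h1 := norm_sub_le 1 s
      rw [norm_one] at h1
      have h2 := mem_ball_zero_iff.1 hs
      nlinarith
    have hψd : DifferentiableOn ℂ ψ (ball 0 1) :=
      ((hFd.comp (by fun_prop) hre).smul_const (ν p)).const_add p
    have hb : ‖((1 - 2 * x / ρ : ℝ) : ℂ)‖ = 1 - 2 * x / ρ := by
      rw [Complex.norm_real, Real.norm_eq_abs, abs_of_nonneg]
      rw [sub_nonneg, div_le_one hρ]
      linarith
    have hψz : ψ ((1 - 2 * x / ρ : ℝ) : ℂ) = z := by
      have e : ((ρ / 2 : ℝ) : ℂ) * (1 - ((1 - 2 * x / ρ : ℝ) : ℂ)) = (x : ℂ) := by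
        rw [← Complex.ofReal_one, ← Complex.ofReal_sub, ← Complex.ofReal_mul]
        congr 1
        field_simp
        ring
      simp only [hψ]
      rw [e, hFxd, Complex.coe_smul, ← hnormal]
      abel
    have hxpos : 0 < 2 * x / ρ := by
      have : 0 < x := by linarith
      positivity
    have key := norm_apply_zero_le_of_apply_eq_zero (f := fun s => f (ψ s)) (hf.comp hψd hψm)
      (hfm.comp hψm) (b := ((1 - 2 * x / ρ : ℝ) : ℂ)) (by rw [hb]; linarith)
      (by rw [hψz, hfz])
    have hψ0 : ψ 0 = p + F₀ • ν p := by simp [hψ, hF₀]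
    rw [hb, hψ0] at key
    rw [hdist, div_mul_eq_mul_div, one_mul]
    have : ‖z - p‖ / ρ ≤ 2 * x / ρ := by
      gcongr
      linarith
    linarith

end DiscsAtTheBoundary

/-! ### The squeezing function -/

/-- The hypothesis on the squeezing function in terms of injections of `D` into the ball. -/
theorem frequently_exists_injection {n : ℕ} {D : Set (EuclideanSpace ℂ (Fin n))}
    {p₀ : EuclideanSpace ℂ (Fin n)} (hD : IsOpen D) (hp₀ : p₀ ∈ frontier D)
    (hlim : liminf (fun z => (((1 - squeezingFunction D z) / boundaryDist D z : ℝ) : EReal))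
      (𝓝[D] p₀) = 0) {ε : ℝ} (hε : 0 < ε) :
    ∃ᶠ z in 𝓝[D] p₀, ∃ s, 0 ≤ s ∧ 1 - s < ε * boundaryDist D z ∧
      ∃ f : EuclideanSpace ℂ (Fin n) → EuclideanSpace ℂ (Fin n), DifferentiableOn ℂ f D ∧
        MapsTo f D (ball 0 1) ∧ InjOn f D ∧ f z = 0 ∧ ball 0 s ⊆ f '' D := by
  have h1 : ∃ᶠ z in 𝓝[D] p₀,
      (((1 - squeezingFunction D z) / boundaryDist D z : ℝ) : EReal) < (ε : EReal) :=
    frequently_lt_of_liminf_lt (by isBoundedDefault) (by rw [hlim]; exact_mod_cast hε)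
  have h2 : ∀ᶠ z in 𝓝[D] p₀, z ∈ D ∧ z ∈ ball p₀ (1 / ε) :=
    Eventually.and self_mem_nhdsWithin
      (mem_nhdsWithin_of_mem_nhds (ball_mem_nhds p₀ (by positivity)))
  refine (h1.and_eventually h2).mono ?_
  rintro z ⟨hz, hzD, hzp⟩
  have hpos : 0 < boundaryDist D z := by
    refine (isClosed_frontier.notMem_iff_infDist_pos ⟨p₀, hp₀⟩).1 fun hzf => ?_
    exact (hD.frontier_eq ▸ hzf).2 hzD
  have hlt : 1 - squeezingFunction D z < ε * boundaryDist D z := by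
    rwa [EReal.coe_lt_coe_iff, div_lt_iff₀ hpos] at hz
  have hsmall : ε * boundaryDist D z < 1 := by
    have h3 : boundaryDist D z < 1 / ε := (infDist_le_dist_of_mem hp₀).trans_lt hzp
    rwa [lt_div_iff₀ hε, mul_comm] at h3
  -- this excludes the convention `s_D(z) = 0` for an empty set of radii
  have hne : {r : ℝ | 0 ≤ r ∧ ∃ f : EuclideanSpace ℂ (Fin n) → EuclideanSpace ℂ (Fin n),
      DifferentiableOn ℂ f D ∧ MapsTo f D (ball 0 1) ∧ InjOn f D ∧ f z = 0 ∧
        ball 0 r ⊆ f '' D}.Nonempty := by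
    by_contra hempty
    rw [not_nonempty_iff_eq_empty] at hempty
    rw [squeezingFunction, hempty, Real.sSup_empty] at hlt
    linarith
  obtain ⟨s, ⟨hs0, hs⟩, hlts⟩ := exists_lt_of_lt_csSup hne
    (show 1 - ε * boundaryDist D z < sSup _ by rw [squeezingFunction] at hlt; linarith)
  exact ⟨s, hs0, by linarith, hs⟩

theorem proposition8 (n : ℕ) (D : Set (EuclideanSpace ℂ (Fin n))) (hD : IsOpen D)
    (hDc : IsConnected D) (p₀ : EuclideanSpace ℂ (Fin n))
    (hp₀ : IsDiniSmoothBoundaryPoint D p₀)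
    (hlim : liminf (fun z => (((1 - squeezingFunction D z) / boundaryDist D z : ℝ) : EReal))
      (𝓝[D] p₀) = 0) :
    Biholomorphic D (ball 0 1) := by
  obtain ⟨a₀, ha₀, c, hc, hz⟩ := hp₀.exists_mul_boundaryDist_le hD
  have hex : ∀ j : ℕ, ∃ (g : EuclideanSpace ℂ (Fin n) → EuclideanSpace ℂ (Fin n))
      (a : EuclideanSpace ℂ (Fin n)), (DifferentiableOn ℂ g D ∧ MapsTo g D (ball 0 1) ∧
        InjOn g D) ∧ g a = 0 ∧ dist a a₀ < 1 / ((j : ℝ) + 1) ∧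
        ball 0 (1 - 1 / ((j : ℝ) + 1)) ⊆ g '' D := by
    intro j
    have hj : (0 : ℝ) < 1 / ((j : ℝ) + 1) := by positivity
    obtain ⟨z, ⟨s, hs0, hs, f, hf, hfm, hfi, hfz, hfs⟩, a, haD, ha, hfa⟩ :=
      ((frequently_exists_injection hD hp₀.1 hlim
        (show 0 < c * (1 / ((j : ℝ) + 1)) / 8 by positivity)).and_eventually
          (hz _ hj)).exists
    have hb : ‖f a‖ < 1 := by simpa using hfm haD
    refine ⟨ballInvolution (f a) ∘ f, a,
      ⟨(differentiableOn_ballInvolution hb).comp hf hfm, (mapsTo_ballInvolution hb).comp hfm,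
        (injOn_ballInvolution hb).comp hfi hfm⟩, ballInvolution_self hb, ha, ?_⟩
    rw [image_comp]
    refine (ball_subset_image_ballInvolution hb hs0 (by linarith) ?_).trans (image_mono hfs)
    have h1 := hfa f hf hfm hfz
    have h2 := mul_le_mul_of_nonneg_right h1 hj.le
    linarith
  choose g a hg hga ha hgr using hex
  exact exists_biholomorphism_of_exhausting_injections hD hDc ha₀ (fun j => (hg j).1)
    (fun j => (hg j).2.1) (fun j => (hg j).2.2)
    (tendsto_iff_dist_tendsto_zero.2 (squeeze_zero (fun _ => dist_nonneg) (fun j => (ha j).le)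
      tendsto_one_div_add_atTop_nhds_zero_nat)) hga
    (by simpa using (tendsto_one_div_add_atTop_nhds_zero_nat (𝕜 := ℝ)).const_sub 1) hgr
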